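/- Let $k$ be a field and let $\mathcal H$ be a $k$-linear hereditary abelian category that is Hom-finite and Ext-finite, i.e. $\operatorname{Hom}_{\mathcal H}(X,Y)$ and $\operatorname{Ext}^1_{\mathcal H}(X,Y)$ are finite-dimensional over $k$ and $\operatorname{Ext}^2_{\mathcal H}(X,Y)=0$ for all $X,Y\in\mathcal H$. Let $D$ be a presilting object of the bounded derived category $\mathcal D^b(\mathcal H)$, i.e. $\operatorname{Hom}_{\mathcal D^b(\mathcal H)}(D,D[n])=0$ for all $n>0$. Let $$D^{\perp_{\mathbb Z}}=\{M\in\mathcal H \mid \operatorname{Hom}_{\mathcal D^b(\mathcal H)}(D,M[n])=0 \text{ for all } n\in\mathbb Z\},$$ regarded as a full subcategory of $\mathcal H$, and let $\operatorname{thick} D$ be the smallest triangulated subcategory of $\mathcal D^b(\mathcal H)$ that is closed under direct summands and contains $D$. Then $D^{\perp_{\mathbb Z}}$ contains $0$ and is closed under finite direct sums, kernels and cokernels in $\mathcal H$, hence is an abelian category; it is again a Hom-finite and Ext-finite $k$-linear hereditary abelian category; and there is a $k$-linear triangle equivalence $$\mathcal D^b(D^{\perp_{\mathbb Z}})\;\simeq\;\mathcal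 D^b(\mathcal H)/\operatorname{thick} D,$$ where the right-hand side is the Verdier quotient. -/

import Mathlib

open CategoryTheory Limits Pretriangulated Triangulated

universe t w w' v u

/-- A Hom-finite and Ext-finite `k`-linear hereditary abelian category: `Hom(X, Y)` and
`Ext¹(X, Y)` are finite-dimensional and `Ext²(X, Y) = 0` for all objects `X` and `Y`. -/
structure IsHereditaryAbelian (k : Type t) [Field k] (A : Type u) [Category.{v} A] [Abelian A]
    [Linear k A] : Prop where
  hom_finite (X Y : A) : Module.Finite k (X ⟶ Y)
  ext_finite (X Y : A) :
    haveI := HasExt.standard A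
    Module.Finite k (Abelian.Ext.{max u v} X Y 1)
  ext_two (X Y : A) :
    haveI := HasExt.standard A
    Subsingleton (Abelian.Ext.{max u v} X Y 2)

/-- The object `M` of `H`, seen in the bounded derived category as a complex
concentrated in degree `0`. -/
noncomputable def boundedStalk {H : Type u} [Category.{v} H] [Abelian H]
    [HasDerivedCategory.{w} H] (M : H) : DerivedCategory.Bounded H :=
  ⟨(DerivedCategory.singleFunctor H 0).obj M,
    ⟨⟨0, inferInstance⟩, ⟨0, inferInstance⟩⟩⟩

/-- `T` is presilting if `Hom(T, T[n]) = 0` for all `n > 0`. -/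
def IsPresilting {C : Type u} [Category.{v} C] [Preadditive C] [HasShift C ℤ] (T : C) : Prop :=
  ∀ n : ℤ, 0 < n → ∀ f : T ⟶ T⟦n⟧, f = 0

/-- The perpendicular category of `D`: the full subcategory of `H` on the objects `M` such that
`Hom(D, M[n]) = 0` in the bounded derived category, for all integers `n`. -/
def perpZ {H : Type u} [Category.{v} H] [Abelian H] [HasDerivedCategory.{w} H]
    (D : DerivedCategory.Bounded H) : ObjectProperty H :=
  fun M => ∀ n : ℤ, ∀ f : D ⟶ (boundedStalk M)⟦n⟧, f = 0

/-- The smallest thick subcategory containing `X`, that is, the smallest triangulated subcategory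
which is closed under direct summands and contains `X`. -/
abbrev thick {C : Type u} [Category.{v} C] [HasZeroObject C] [HasShift C ℤ] [Preadditive C]
    [∀ n : ℤ, (shiftFunctor C n).Additive] [Pretriangulated C] (X : C) : ObjectProperty C :=
  (ObjectProperty.singleton X).triangEnvelope

/-- The Verdier quotient of `C` by the thick subcategory generated by `X`: the localization of `C`
at the morphisms whose cone lies in `thick X`. -/
abbrev VerdierQuotient {C : Type u} [Category.{v} C] [HasZeroObject C] [HasShift C ℤ]
    [Preadditive C] [∀ n : ℤ, (shiftFunctor C n).Additive] [Pretriangulated C] (X : C) :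
    Type u :=
  (thick X).trW.Localization

/-!
As `Ext²` vanishes, every object of `Dᵇ(H)` is a finite direct sum of shifted stalks, and the
perpendicular category of `D` is closed under images: for a stalk summand `T` of `D`, a subobject
of `N` inherits `Hom(T, -) = 0` from `N`, and a quotient of `M` inherits `Ext¹(T, -) = 0` from `M`.
Kernels, cokernels and extensions follow by two-out-of-three.

The decomposition of `D` is semi-orthogonal, with shifts of rigid stalks `T` as terms, so `thick D`
is right admissible as soon as `thick T` is. For the latter, a universal extension embeds `M` in
some `M'` with `Ext¹(T, M') = 0`, with cokernel a power of `T`. Approximate `M'` by a map from a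
power of `T`, and then its kernel by a second one: both cokernels are perpendicular to `T`, and the
image of the second map, lying between two powers of `T`, is a direct summand of their sum.

An extension-closed exact embedding in a hereditary category is bijective on all `Ext` groups, so
the bounded derived category of the perpendicular category embeds in `Dᵇ(H)`, with image in the
right orthogonal of `thick D`. There the quotient functor is bijective on morphisms, and by right
admissibility this image and `thick D` generate `Dᵇ(H)`.
-/

/-! ### Orthogonals and thick subcategories -/

section Orthogonal

open ObjectProperty

variable {C : Type*} [Category* C]

instance isStableUnderRetracts_rightOrthogonal [HasZeroMorphisms C] (P : ObjectProperty C) :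
    P.rightOrthogonal.IsStableUnderRetracts where
  of_retract r h X f hX := by
    rw [← Category.comp_id f, ← r.retract, ← Category.assoc, h (f ≫ r.i) hX, zero_comp]

instance isStableUnderRetracts_leftOrthogonal [HasZeroMorphisms C] (P : ObjectProperty C) :
    P.leftOrthogonal.IsStableUnderRetracts where
  of_retract r h X f hX := by
    rw [← Category.id_comp f, ← r.retract, Category.assoc, h (r.r ≫ f) hX, comp_zero]

variable [HasZeroObject C] [HasShift C ℤ] [Preadditive C]
  [∀ n : ℤ, (shiftFunctor C n).Additive] [Pretriangulated C]

lemma prop_biprod_of_isTriangulatedClosed₂ (P : ObjectProperty C) [P.IsTriangulatedClosed₂]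
    [P.IsClosedUnderIsomorphisms] {X Y : C} (hX : P X) (hY : P Y) : P (X ⊞ Y) :=
  P.ext_of_isTriangulatedClosed₂ _ (binaryBiproductTriangle_distinguished X Y) hX hY

lemma extensionProduct_swap_le (P Q : ObjectProperty C) [Q.IsStableUnderShift ℤ]
    (h : P ≤ Q.leftOrthogonal) : extensionProduct Q P ≤ extensionProduct P Q := by
  rintro X ⟨Y, Z, f, g, δ, hT, hY, hZ⟩
  obtain ⟨e, -, -⟩ := exists_iso_binaryBiproduct_of_distTriang _ hT
    (h Z hZ δ (Q.le_shift _ _ hY))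
  refine (extensionProduct P Q).prop_of_iso (biprod.braiding Z Y ≪≫ e.symm) ?_
  exact ⟨_, _, _, _, _, binaryBiproductTriangle_distinguished Z Y, hZ, hY⟩

lemma extensionProduct_self_le_of_le_leftOrthogonal [IsTriangulated C] (P Q : ObjectProperty C)
    [P.IsTriangulatedClosed₂] [Q.IsTriangulatedClosed₂] [Q.IsStableUnderShift ℤ]
    [P.IsClosedUnderIsomorphisms] [Q.IsClosedUnderIsomorphisms] (h : P ≤ Q.leftOrthogonal) :
    extensionProduct (extensionProduct P Q) (extensionProduct P Q) ≤ extensionProduct P Q := by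
  have hPP : extensionProduct P P ≤ P := extensionProduct_le_of_isTriangulatedClosed₂ le_rfl le_rfl
  have hQQ : extensionProduct Q Q ≤ Q := extensionProduct_le_of_isTriangulatedClosed₂ le_rfl le_rfl
  calc extensionProduct (extensionProduct P Q) (extensionProduct P Q)
    _ = extensionProduct P (extensionProduct (extensionProduct Q P) Q) := by
      rw [extensionProduct_assoc, extensionProduct_assoc]
    _ ≤ extensionProduct P (extensionProduct (extensionProduct P Q) Q) :=
      monotone_extensionProduct_right _
        (monotone_extensionProduct_left _ (extensionProduct_swap_le P Q h))
    _ = extensionProduct (extensionProduct P P) (extensionProduct Q Q) := by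
      rw [extensionProduct_assoc, extensionProduct_assoc]
    _ ≤ extensionProduct P Q :=
      (monotone_extensionProduct_left _ hPP).trans (monotone_extensionProduct_right _ hQQ)

lemma isTriangulated_extensionProduct [IsTriangulated C] (P Q : ObjectProperty C)
    [P.IsTriangulated] [Q.IsTriangulated] [P.IsClosedUnderIsomorphisms]
    [Q.IsClosedUnderIsomorphisms] (h : P ≤ Q.leftOrthogonal) :
    (extensionProduct P Q).IsTriangulated where
  exists_zero := by
    obtain ⟨Z, hZ, hP⟩ := P.exists_prop_of_containsZero
    exact ⟨Z, hZ, le_extensionProduct_left _ _ hP⟩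
  toIsTriangulatedClosed₂ := .mk' fun _ hT h₁ h₃ =>
    extensionProduct_self_le_of_le_leftOrthogonal P Q h _ ⟨_, _, _, _, _, hT, h₁, h₃⟩

end Orthogonal

section Thick

variable {C : Type*} [Category* C] [HasZeroObject C] [HasShift C ℤ] [Preadditive C]
  [∀ n : ℤ, (shiftFunctor C n).Additive] [Pretriangulated C]

lemma thick_le_iff {P : ObjectProperty C} [P.IsStableUnderRetracts] [P.IsTriangulated] {X : C} :
    thick X ≤ P ↔ P X := by
  rw [ObjectProperty.triangEnvelope_le_iff, ObjectProperty.singleton_le_iff]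

/-- The right orthogonal of `thick X`, which by `thickPerp_iff` consists of the objects `Y` such
that `Hom(X, Y[n]) = 0` for all `n`. -/
abbrev thickPerp (X : C) : ObjectProperty C := (thick X).rightOrthogonal

lemma thickPerp_shift_iff {X Y : C} (n : ℤ) : thickPerp X (Y⟦n⟧) ↔ thickPerp X Y :=
  (thickPerp X).prop_shift_iff_of_isStableUnderShift Y n

/-- `thick X` is right admissible. Instead of a right adjoint of its inclusion, the definition asks
that every object be an extension of an object of the right orthogonal by an object of `thick X`. -/
def IsRightAdmissible (X : C) : Prop :=
  ObjectProperty.extensionProduct (thick X) (thickPerp X) = ⊤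

lemma IsRightAdmissible.of_thick_eq {X Y : C} (h : thick X = thick Y)
    (hX : IsRightAdmissible X) : IsRightAdmissible Y := by
  rwa [IsRightAdmissible, thickPerp, ← h]

variable [IsTriangulated C]

lemma thick_self (X : C) : thick X X := thick_le_iff.1 le_rfl

lemma thickPerp_iff {X Y : C} : thickPerp X Y ↔ ∀ (n : ℤ) (f : X ⟶ Y⟦n⟧), f = 0 := by
  refine ⟨fun h n f => (thickPerp X).le_shift n _ h f (thick_self X), fun h Z f hZ => ?_⟩
  let S := (ObjectProperty.singleton Y).shiftClosure ℤ
  have hS : thick X ≤ S.leftOrthogonal := by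
    rw [thick_le_iff]
    rintro W g ⟨Y', n, e, hY'⟩
    obtain rfl : Y = Y' := by simpa using hY'
    rw [← cancel_mono e.hom, h n (g ≫ e.hom), zero_comp]
  exact hS Z hZ f ((ObjectProperty.singleton Y).le_shiftClosure _ (by simp))

lemma thickPerp_of_isZero {X : C} (hX : IsZero X) (Y : C) : thickPerp X Y :=
  thickPerp_iff.2 fun _ _ => hX.eq_of_src _ _

lemma thick_shift (X : C) (n : ℤ) : thick (X⟦n⟧) = thick X :=
  le_antisymm (thick_le_iff.2 ((thick X).le_shift n _ (thick_self X)))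
    (thick_le_iff.2 (((thick (X⟦n⟧)).prop_shift_iff_of_isStableUnderShift X n).1 (thick_self _)))

lemma thick_congr {X Y : C} (e : X ≅ Y) : thick X = thick Y :=
  le_antisymm (thick_le_iff.2 ((thick Y).prop_of_iso e.symm (thick_self Y)))
    (thick_le_iff.2 ((thick X).prop_of_iso e (thick_self X)))

lemma thick_le_thick_biprod_left (X Y : C) : thick X ≤ thick (X ⊞ Y) :=
  thick_le_iff.2 (ObjectProperty.IsStableUnderRetracts.of_biprod_left _ (thick_self (X ⊞ Y)))

lemma thick_le_thick_biprod_right (X Y : C) : thick Y ≤ thick (X ⊞ Y) :=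
  thick_le_iff.2 (ObjectProperty.IsStableUnderRetracts.of_biprod_right _ (thick_self (X ⊞ Y)))

lemma thickPerp_biprod_iff {X X' Y : C} :
    thickPerp (X ⊞ X') Y ↔ thickPerp X Y ∧ thickPerp X' Y := by
  refine ⟨fun h => ⟨fun Z f hZ => h f (thick_le_thick_biprod_left _ _ _ hZ),
    fun Z f hZ => h f (thick_le_thick_biprod_right _ _ _ hZ)⟩, fun ⟨h, h'⟩ => ?_⟩
  rw [thickPerp_iff] at h h' ⊢
  intro n f
  ext
  · simpa using h n _
  · simpa using h' n _

lemma isTriangulated_extensionProduct_thick (X : C) :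
    (ObjectProperty.extensionProduct (thick X) (thickPerp X)).IsTriangulated :=
  isTriangulated_extensionProduct _ _ fun _ hZ _ f hY => hY f hZ

lemma isRightAdmissible_of_isZero {X : C} (hX : IsZero X) : IsRightAdmissible X :=
  eq_top_iff.2 fun Y _ =>
    ObjectProperty.le_extensionProduct_right (P := thick X) _ (thickPerp_of_isZero hX Y)

lemma IsRightAdmissible.biprod {X Y : C} (hX : IsRightAdmissible X) (hY : IsRightAdmissible Y)
    (h : thickPerp X Y) : IsRightAdmissible (X ⊞ Y) := by
  have hle : thick Y ≤ thickPerp X := thick_le_iff.2 h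
  rw [IsRightAdmissible, eq_top_iff]
  intro Z _
  obtain ⟨A, B, a, b, c, hT, hA, hB⟩ : ObjectProperty.extensionProduct _ _ Z := hX.ge Z trivial
  obtain ⟨A', B', a', b', c', hT', hA', hB'⟩ : ObjectProperty.extensionProduct _ _ B :=
    hY.ge B trivial
  have hXB' : thickPerp X B' := (thickPerp X).ext_of_isTriangulatedClosed₃ _ hT' (hle _ hA') hB
  have hZ : ObjectProperty.extensionProduct (thick X)
      (ObjectProperty.extensionProduct (thick Y) (thickPerp (X ⊞ Y))) Z :=
    ⟨A, B, a, b, c, hT, hA, A', B', a', b', c', hT', hA', thickPerp_biprod_iff.2 ⟨hXB', hB'⟩⟩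
  rw [← ObjectProperty.extensionProduct_assoc] at hZ
  exact ObjectProperty.monotone_extensionProduct_left _
    (ObjectProperty.extensionProduct_le_of_isTriangulatedClosed₂
      (thick_le_thick_biprod_left X Y) (thick_le_thick_biprod_right X Y)) _ hZ

end Thick

section BiproductHom

variable {A C : Type*} [Category* A] [Category* C] [Preadditive A] [Preadditive C]
  [HasFiniteBiproducts A] (F : A ⥤ C) [F.Additive] {J : Type} [Finite J] (T : J → A)

lemma hom_from_map_biproduct_eq_zero {W : C}
    (h : ∀ j (g : F.obj (T j) ⟶ W), g = 0) (f : F.obj (⨁ T) ⟶ W) : f = 0 := by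
  rw [← cancel_epi (F.mapBiproduct T).inv, comp_zero]
  exact biproduct.hom_ext' _ _ fun j => (h j _).trans comp_zero.symm

lemma hom_to_map_biproduct_eq_zero {W : C}
    (h : ∀ j (g : W ⟶ F.obj (T j)), g = 0) (f : W ⟶ F.obj (⨁ T)) : f = 0 := by
  rw [← cancel_mono (F.mapBiproduct T).hom, zero_comp]
  exact biproduct.hom_ext _ _ fun j => (h j _).trans zero_comp.symm

end BiproductHom

section ShiftHom

variable {C : Type*} [Category* C] [HasShift C ℤ] [Preadditive C]

lemma hom_shift_shift_eq_zero {X Y : C} {a b c : ℤ} (h : a + b = c)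
    (hXY : ∀ g : X ⟶ Y⟦c⟧, g = 0) (f : X ⟶ Y⟦a⟧⟦b⟧) : f = 0 := by
  rw [← cancel_mono ((shiftFunctorAdd' C a b c h).inv.app Y), hXY (_ ≫ _), zero_comp]

lemma hom_shift_zero_eq_zero_iff {X Y : C} :
    (∀ f : X ⟶ Y⟦(0 : ℤ)⟧, f = 0) ↔ ∀ f : X ⟶ Y, f = 0 := by
  refine ⟨fun h f => ?_, fun h f => ?_⟩
  · rw [← cancel_mono ((shiftFunctorZero C ℤ).inv.app Y), h (_ ≫ _), zero_comp]
  · rw [← cancel_mono ((shiftFunctorZero C ℤ).hom.app Y), h (_ ≫ _), zero_comp]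

variable [∀ n : ℤ, (shiftFunctor C n).Additive]

lemma hom_from_shift_eq_zero {X Y : C} {a b c : ℤ} (h : c + a = b)
    (hXY : ∀ g : X ⟶ Y⟦c⟧, g = 0) (f : X⟦a⟧ ⟶ Y⟦b⟧) : f = 0 := by
  obtain ⟨g, hg⟩ := (shiftFunctor C a).map_surjective
    (f ≫ (shiftFunctorAdd' C c a b h).hom.app Y)
  rw [← cancel_mono ((shiftFunctorAdd' C c a b h).hom.app Y), ← hg, hXY g, Functor.map_zero,
    zero_comp]

variable [HasZeroObject C] [Pretriangulated C] {X₁ X₂ X₃ : C} {f : X₁ ⟶ X₂} {g : X₂ ⟶ X₃}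
  {δ : X₃ ⟶ X₁⟦(1 : ℤ)⟧}

lemma exists_shift_lift₃ (hT : Triangle.mk f g δ ∈ distTriang C) {W : C} {n m : ℤ} (h : n + 1 = m)
    (hW : ∀ a : W ⟶ X₁⟦m⟧, a = 0) (φ : W ⟶ X₃⟦n⟧) :
    ∃ ψ : W ⟶ X₂⟦n⟧, φ = ψ ≫ g⟦n⟧' := by
  obtain ⟨ψ, rfl⟩ : ∃ ψ : W ⟶ X₂⟦n⟧, φ = ψ ≫ (n.negOnePow • g⟦n⟧') :=
    Triangle.coyoneda_exact₃ _ (Triangle.shift_distinguished _ hT n) φ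
      (hom_shift_shift_eq_zero h hW _)
  exact ⟨n.negOnePow • ψ, by rw [Linear.units_smul_comp, Linear.comp_units_smul]⟩

lemma exists_shift_lift₂ (hT : Triangle.mk f g δ ∈ distTriang C) {W : C} {n : ℤ}
    (φ : W ⟶ X₂⟦n⟧) (hφ : φ ≫ g⟦n⟧' = 0) :
    ∃ ψ : W ⟶ X₁⟦n⟧, φ = ψ ≫ f⟦n⟧' := by
  have hφ' : φ ≫ (n.negOnePow • g⟦n⟧') = 0 := by rw [Linear.comp_units_smul, hφ, smul_zero]
  obtain ⟨ψ, rfl⟩ : ∃ ψ : W ⟶ X₁⟦n⟧, φ = ψ ≫ (n.negOnePow • f⟦n⟧') :=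
    Triangle.coyoneda_exact₂ _ (Triangle.shift_distinguished _ hT n) φ hφ'
  exact ⟨n.negOnePow • ψ, by rw [Linear.units_smul_comp, Linear.comp_units_smul]⟩

lemma hom_shift_obj₃_eq_zero (hT : Triangle.mk f g δ ∈ distTriang C) {W : C} {n m : ℤ}
    (h : n + 1 = m) (h₁ : ∀ a : W ⟶ X₁⟦m⟧, a = 0) (h₂ : ∀ a : W ⟶ X₂⟦n⟧, a = 0)
    (φ : W ⟶ X₃⟦n⟧) : φ = 0 := by
  obtain ⟨ψ, rfl⟩ := exists_shift_lift₃ hT h h₁ φ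
  rw [h₂ ψ, zero_comp]

lemma exists_desc_of_comp_connecting_eq_zero (hT : Triangle.mk f g δ ∈ distTriang C) {W : C}
    (φ : X₁⟦(1 : ℤ)⟧ ⟶ W) (hφ : δ ≫ φ = 0) : ∃ ψ : X₂⟦(1 : ℤ)⟧ ⟶ W, φ = f⟦(1 : ℤ)⟧' ≫ ψ := by
  obtain ⟨ψ, rfl⟩ : ∃ ψ : X₂⟦(1 : ℤ)⟧ ⟶ W, φ = (-f⟦(1 : ℤ)⟧') ≫ ψ :=
    Triangle.yoneda_exact₂ _ (rot_of_distTriang _ (rot_of_distTriang _ hT)) φ hφ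
  exact ⟨-ψ, by rw [Preadditive.neg_comp, Preadditive.comp_neg]⟩

lemma thick_map_biproduct [IsTriangulated C] {A : Type*} [Category* A] [Preadditive A]
    [HasFiniteBiproducts A] (F : A ⥤ C) [F.Additive] (T : A) (J : Type) [Finite J] :
    thick (F.obj T) (F.obj (⨁ fun _ : J => T)) := by
  refine (thick (F.obj T)).prop_of_iso (F.mapBiproduct _ ≪≫ biproduct.isoProduct _).symm ?_
  exact ObjectProperty.prop_pi _ _ fun _ => thick_self _

end ShiftHom

section FiniteHom

variable {R : Type*} [Semiring R] {C : Type*} [Category* C] [Preadditive C] [Linear R C]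

lemma finite_hom_of_retract {X Y : C} (r : Retract X Y) (Z : C) [Module.Finite R (Y ⟶ Z)] :
    Module.Finite R (X ⟶ Z) :=
  Module.Finite.of_surjective (Linear.leftComp R Z r.i) fun f => ⟨r.r ≫ f, by simp⟩

lemma finite_hom_biprod (X Y Z : C) [HasBinaryBiproduct X Y] [Module.Finite R (X ⟶ Z)]
    [Module.Finite R (Y ⟶ Z)] : Module.Finite R (X ⊞ Y ⟶ Z) :=
  Module.Finite.of_surjective
    ((Linear.leftComp R Z (biprod.fst : X ⊞ Y ⟶ X)).coprod (Linear.leftComp R Z biprod.snd))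
    fun f => ⟨(biprod.inl ≫ f, biprod.inr ≫ f), by ext <;> simp⟩

lemma finite_hom_shift_iff [HasShift C ℤ] [∀ n : ℤ, (shiftFunctor C n).Additive]
    [∀ n : ℤ, (shiftFunctor C n).Linear R] (X Y : C) {a b c : ℤ} (h : c + a = b) :
    Module.Finite R (X⟦a⟧ ⟶ Y⟦b⟧) ↔ Module.Finite R (X ⟶ Y⟦c⟧) :=
  Module.Finite.equiv_iff <| .symm <|
    (LinearEquiv.ofBijective ((shiftFunctor C a).mapLinearMap R)
      (Functor.FullyFaithful.map_bijective (.ofFullyFaithful _) X (Y⟦c⟧))).trans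
    (Linear.homCongr R (Iso.refl _) ((shiftFunctorAdd' C c a b h).app Y).symm)

lemma finite_hom_shift_zero_iff [HasShift C ℤ] (X Y : C) :
    Module.Finite R (X ⟶ Y⟦(0 : ℤ)⟧) ↔ Module.Finite R (X ⟶ Y) :=
  Module.Finite.equiv_iff (Linear.homCongr R (Iso.refl _) ((shiftFunctorZero C ℤ).app Y))

end FiniteHom

section Approximation

/-- `φ : X ⟶ Y` is a right approximation of `Y` by `T`, that is, every morphism from `T` to `Y`
factors through `φ`. Unlike the right `add T`-approximations of the literature, `X` need not
be a summand of a sum of copies of `T`. -/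
def IsRightApproximation {C : Type*} [Category* C] (T : C) {X Y : C} (φ : X ⟶ Y) : Prop :=
  ∀ g : T ⟶ Y, ∃ h : T ⟶ X, h ≫ φ = g

lemma IsRightApproximation.of_map {A C : Type*} [Category* A] [Category* C] (F : A ⥤ C) [F.Full]
    [F.Faithful] {T X Y : A} {φ : X ⟶ Y} (h : IsRightApproximation (F.obj T) (F.map φ)) :
    IsRightApproximation T φ := by
  intro g
  obtain ⟨g', hg'⟩ := h (F.map g)
  obtain ⟨g', rfl⟩ := F.map_surjective g'
  exact ⟨g', F.map_injective (by rw [F.map_comp, hg'])⟩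

variable (R : Type*) [Semiring R] {A C : Type*} [Category* A] [Category* C] [Preadditive A]
  [HasFiniteBiproducts A] [Preadditive C] [Linear R C] (F : A ⥤ C) [F.Additive] (T : A)

lemma exists_isRightApproximation (Y : C) [Module.Finite R (F.obj T ⟶ Y)] :
    ∃ (m : ℕ) (φ : F.obj (⨁ fun _ : Fin m => T) ⟶ Y), IsRightApproximation (F.obj T) φ := by
  obtain ⟨m, b, hb⟩ := Module.Finite.exists_fin (R := R) (M := F.obj T ⟶ Y)
  refine ⟨m, (F.mapBiproduct _).hom ≫ biproduct.desc b, fun g => ?_⟩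
  obtain ⟨r, rfl⟩ := (Submodule.mem_span_range_iff_exists_fun R).1 (hb ▸ Submodule.mem_top : g ∈ _)
  refine ⟨biproduct.lift (fun i => r i • 𝟙 _) ≫ (F.mapBiproduct _).inv, ?_⟩
  rw [Category.assoc, Iso.inv_hom_id_assoc, biproduct.lift_desc]
  simp only [Linear.smul_comp, Category.id_comp]

lemma exists_isRightApproximation_of_full [F.Full] [F.Faithful] (Y : A)
    [Module.Finite R (F.obj T ⟶ F.obj Y)] :
    ∃ (m : ℕ) (φ : (⨁ fun _ : Fin m => T) ⟶ Y), IsRightApproximation T φ := by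
  obtain ⟨m, φ, hφ⟩ := exists_isRightApproximation R F T (F.obj Y)
  obtain ⟨φ, rfl⟩ := F.map_surjective φ
  exact ⟨m, φ, .of_map F hφ⟩

end Approximation

/-! ### Approximations and hereditary hearts -/

section Heart

variable {H : Type*} [Category* H]
  {C : Type*} [Category* C] [HasZeroObject C] [HasShift C ℤ] [Preadditive C]
  [∀ n : ℤ, (shiftFunctor C n).Additive] [Pretriangulated C]

/-- `HeartSum s b X` says that `X` is a finite direct sum of objects `s(M)[-i]` with `i < b`,
with at most one summand for each `i`. -/
inductive HeartSum (s : H ⥤ C) : ℤ → C → Prop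
  | zero (b : ℤ) (X : C) (hX : IsZero X) : HeartSum s b X
  | succ (b : ℤ) (X Y : C) (M : H) (hX : HeartSum s b X) (e : Y ≅ X ⊞ (s.obj M)⟦-b⟧) :
      HeartSum s (b + 1) Y

lemma HeartSum.hom_shift_eq_zero {s : H ⥤ C}
    (hs : ∀ (X Y : H) (n : ℤ), 2 ≤ n → ∀ f : s.obj X ⟶ (s.obj Y)⟦n⟧, f = 0)
    {b : ℤ} {X : C} (hX : HeartSum s b X) (N : H) (m : ℤ) (hm : m ≤ -b)
    (f : (s.obj N)⟦m⟧ ⟶ X⟦(1 : ℤ)⟧) : f = 0 := by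
  induction hX with
  | zero b X hX => exact ((shiftFunctor C (1 : ℤ)).map_isZero hX).eq_of_tgt _ _
  | succ b X Y M _ e ih =>
    have h₁ (g : (s.obj N)⟦m⟧ ⟶ X⟦(1 : ℤ)⟧) : g = 0 := ih (by lia) g
    have h₂ (g : (s.obj N)⟦m⟧ ⟶ (s.obj M)⟦-b⟧⟦(1 : ℤ)⟧) : g = 0 :=
      hom_shift_shift_eq_zero rfl
        (hom_from_shift_eq_zero (c := -b + 1 - m) (by lia) (hs N M _ (by lia))) g
    let S := shiftFunctor C (1 : ℤ)
    have := preservesBinaryBiproducts_of_preservesBiproducts S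
    rw [← cancel_mono (S.map e.hom ≫ (S.mapBiprod _ _).hom), zero_comp]
    exact biprod.hom_ext _ _ ((h₁ _).trans zero_comp.symm) ((h₂ _).trans zero_comp.symm)

variable [Abelian H]

/-- A functor `s` from an abelian category to a triangulated category which behaves as the inclusion
of a hereditary abelian category in its bounded derived category. -/
structure IsHereditaryHeart (s : H ⥤ C) : Prop where
  exists_triangle (S : ShortComplex H) (hS : S.ShortExact) :
    ∃ δ : s.obj S.X₃ ⟶ (s.obj S.X₁)⟦(1 : ℤ)⟧,
      Triangle.mk (s.map S.f) (s.map S.g) δ ∈ distTriang C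
  hom_eq_zero (X Y : H) (n : ℤ) (hn : n < 0 ∨ 2 ≤ n) (f : s.obj X ⟶ (s.obj Y)⟦n⟧) : f = 0
  exists_extension {X Z : H} (c : s.obj Z ⟶ (s.obj X)⟦(1 : ℤ)⟧) :
    ∃ (Y : H) (a : s.obj X ⟶ s.obj Y) (b : s.obj Y ⟶ s.obj Z), Triangle.mk a b c ∈ distTriang C
  exists_heartSum (X : C) : ∃ b, HeartSum s b X

namespace IsHereditaryHeart

variable {s : H ⥤ C} (hs : IsHereditaryHeart s)

include hs

lemma induction {P : C → Prop} (hP : ∀ {X Y : C}, (X ≅ Y) → P X → P Y)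
    (hzero : ∀ X, IsZero X → P X)
    (hadd : ∀ X Y : C, P X → P Y → P (X ⊞ Y)) (hstalk : ∀ (M : H) (n : ℤ), P ((s.obj M)⟦n⟧))
    (X : C) : P X := by
  obtain ⟨b, hX⟩ := hs.exists_heartSum X
  induction hX with
  | zero _ X hX => exact hzero X hX
  | succ b X Y M _ e ih => exact hP e.symm (hadd _ _ ih (hstalk M _))

lemma eq_top {P : ObjectProperty C} [P.IsTriangulated] [P.IsClosedUnderIsomorphisms]
    (hP : ∀ M : H, P (s.obj M)) : P = ⊤ := by
  rw [eq_top_iff]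
  intro X _
  exact hs.induction (P := P) (fun e h => P.prop_of_iso e h) (fun X hX => P.prop_of_isZero hX)
    (fun X Y hX hY => prop_biprod_of_isTriangulatedClosed₂ P hX hY)
    (fun M n => P.le_shift n _ (hP M)) X

lemma heartSum_hom_eq_zero {b : ℤ} {X : C} (hX : HeartSum s b X) (N : H) (m : ℤ) (hm : m ≤ -b)
    (f : X ⟶ (s.obj N)⟦m⟧) : f = 0 := by
  induction hX with
  | zero b X hX => exact hX.eq_of_src _ _
  | succ b X Y M _ e ih =>
    rw [← cancel_epi e.inv, comp_zero]
    ext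
    · exact (ih (by lia) _).trans comp_zero.symm
    · exact (hom_from_shift_eq_zero (c := m + b) (by lia)
        (hs.hom_eq_zero M N (m + b) (.inl (by lia))) _).trans comp_zero.symm

lemma exists_triangle_of_epi {X I : H} (p : X ⟶ I) [Epi p] :
    ∃ δ : s.obj I ⟶ (s.obj (kernel p))⟦(1 : ℤ)⟧,
      Triangle.mk (s.map (kernel.ι p)) (s.map p) δ ∈ distTriang C :=
  hs.exists_triangle (.mk (kernel.ι p) p (kernel.condition p))
    { exact := ShortComplex.exact_kernel p }

lemma exists_triangle_of_mono {I Y : H} (i : I ⟶ Y) [Mono i] :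
    ∃ δ : s.obj (cokernel i) ⟶ (s.obj I)⟦(1 : ℤ)⟧,
      Triangle.mk (s.map i) (s.map (cokernel.π i)) δ ∈ distTriang C :=
  hs.exists_triangle (.mk i (cokernel.π i) (cokernel.condition i))
    { exact := ShortComplex.exact_cokernel i }

lemma exists_triangle_kernel_image {X Y : H} (f : X ⟶ Y) :
    ∃ δ : s.obj (Abelian.image f) ⟶ (s.obj (kernel f))⟦(1 : ℤ)⟧,
      Triangle.mk (s.map (kernel.ι f)) (s.map (Abelian.factorThruImage f)) δ ∈ distTriang C := by
  have hf : kernel.ι f ≫ Abelian.factorThruImage f = 0 := by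
    rw [← cancel_mono (Abelian.image.ι f), Category.assoc, Abelian.image.fac, kernel.condition,
      zero_comp]
  have hker := isKernelOfComp _ _ (kernelIsKernel f) hf (Abelian.image.fac f)
  exact hs.exists_triangle (.mk _ _ hf) { exact := ShortComplex.exact_of_f_is_kernel _ hker }

lemma exists_triangle_image_cokernel {X Y : H} (f : X ⟶ Y) :
    ∃ δ : s.obj (cokernel f) ⟶ (s.obj (Abelian.image f))⟦(1 : ℤ)⟧,
      Triangle.mk (s.map (Abelian.image.ι f)) (s.map (cokernel.π f)) δ ∈ distTriang C :=
  hs.exists_triangle_of_epi (cokernel.π f)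

lemma hom_shift_one_eq_zero_of_epi {T X I : H} (p : X ⟶ I) [Epi p]
    (hX : ∀ f : s.obj T ⟶ (s.obj X)⟦(1 : ℤ)⟧, f = 0) (f : s.obj T ⟶ (s.obj I)⟦(1 : ℤ)⟧) :
    f = 0 := by
  obtain ⟨_, hp⟩ := hs.exists_triangle_of_epi p
  exact hom_shift_obj₃_eq_zero hp (m := 2) (by lia) (hs.hom_eq_zero _ _ 2 (by lia)) hX f

lemma thickPerp_extension (D : C) {S : ShortComplex H} (hS : S.ShortExact)
    (h₁ : thickPerp D (s.obj S.X₁)) (h₃ : thickPerp D (s.obj S.X₃)) :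
    thickPerp D (s.obj S.X₂) := by
  obtain ⟨δ, hT⟩ := hs.exists_triangle S hS
  exact (thickPerp D).ext_of_isTriangulatedClosed₂ _ hT h₁ h₃

variable [s.Additive] [s.Full] [s.Faithful]

lemma nonempty_retract_biprod {X I Y : H} (p : X ⟶ I) (i : I ⟶ Y) [Epi p] [Mono i]
    (hYX : ∀ f : s.obj Y ⟶ (s.obj X)⟦(1 : ℤ)⟧, f = 0) : Nonempty (Retract I (X ⊞ Y)) := by
  obtain ⟨δ, hi⟩ := hs.exists_triangle_of_mono i
  obtain ⟨_, hp⟩ := hs.exists_triangle_of_epi p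
  obtain ⟨δ', hδ'⟩ := exists_shift_lift₃ hp (m := 2) (by lia) (hs.hom_eq_zero _ _ 2 (by lia)) δ
  obtain ⟨r, hr⟩ : ∃ r : (s.obj I)⟦(1 : ℤ)⟧ ⟶ (s.obj X)⟦(1 : ℤ)⟧, δ' = δ ≫ r :=
    Triangle.yoneda_exact₃ _ hi δ' (hYX _)
  let F := s ⋙ shiftFunctor C (1 : ℤ)
  obtain ⟨ρ, rfl⟩ := F.map_surjective r
  have h₀ : δ ≫ F.map (𝟙 I - ρ ≫ p) = 0 := by
    rw [Functor.map_sub, Functor.map_comp, F.map_id, Preadditive.comp_sub,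
      sub_eq_zero, ← Category.assoc, ← hr]
    exact (Category.comp_id δ).trans hδ'
  obtain ⟨q, hq⟩ := exists_desc_of_comp_connecting_eq_zero hi _ h₀
  obtain ⟨σ, rfl⟩ := F.map_surjective q
  have hρσ : ρ ≫ p + i ≫ σ = 𝟙 I := by
    have : 𝟙 I - ρ ≫ p = i ≫ σ := F.map_injective (hq.trans (F.map_comp i σ).symm)
    rw [← this, add_sub_cancel]
  exact ⟨{ i := biprod.lift ρ i, r := biprod.desc p σ, retract := by rw [biprod.lift_desc, hρσ] }⟩

variable [IsTriangulated C]

lemma thickPerp_stalk_iff (T N : H) : thickPerp (s.obj T) (s.obj N) ↔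
    (∀ f : T ⟶ N, f = 0) ∧ ∀ f : s.obj T ⟶ (s.obj N)⟦(1 : ℤ)⟧, f = 0 := by
  have hTN : (∀ f : T ⟶ N, f = 0) ↔ ∀ f : s.obj T ⟶ (s.obj N)⟦(0 : ℤ)⟧, f = 0 := by
    rw [hom_shift_zero_eq_zero_iff, (Functor.FullyFaithful.ofFullyFaithful s).homEquiv.forall_congr]
    exact fun f => (s.map_eq_zero_iff (f := f)).symm
  rw [thickPerp_iff, hTN]
  refine ⟨fun h => ⟨h 0, h 1⟩, fun ⟨h₀, h₁⟩ n f => ?_⟩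
  obtain hn | rfl | rfl : (n < 0 ∨ 2 ≤ n) ∨ n = 0 ∨ n = 1 := by lia
  · exact hs.hom_eq_zero _ _ n hn f
  · exact h₀ f
  · exact h₁ f

lemma thickPerp_image (D : C) {M N : H} (f : M ⟶ N) (hM : thickPerp D (s.obj M))
    (hN : thickPerp D (s.obj N)) : thickPerp D (s.obj (Abelian.image f)) := by
  revert hM hN
  induction D using hs.induction with
  | hP e h => rwa [thickPerp, ← thick_congr e]
  | hzero D hD => exact fun _ _ => thickPerp_of_isZero hD _
  | hadd D D' hD hD' =>
    simp only [thickPerp_biprod_iff]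
    exact fun hM hN => ⟨hD hM.1 hN.1, hD' hM.2 hN.2⟩
  | hstalk T n =>
    rw [thickPerp, thick_shift, ← thickPerp]
    simp only [hs.thickPerp_stalk_iff]
    rintro ⟨-, hM⟩ ⟨hN, -⟩
    refine ⟨fun g => ?_, hs.hom_shift_one_eq_zero_of_epi (Abelian.factorThruImage f) hM⟩
    rw [← cancel_mono (Abelian.image.ι f), hN (g ≫ _), zero_comp]

lemma thickPerp_kernel (D : C) {M N : H} (f : M ⟶ N) (hM : thickPerp D (s.obj M))
    (hN : thickPerp D (s.obj N)) : thickPerp D (s.obj (kernel f)) := by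
  obtain ⟨_, hf⟩ := hs.exists_triangle_kernel_image f
  exact (thickPerp D).ext_of_isTriangulatedClosed₁ _ hf hM (hs.thickPerp_image D f hM hN)

lemma thickPerp_cokernel (D : C) {M N : H} (f : M ⟶ N) (hM : thickPerp D (s.obj M))
    (hN : thickPerp D (s.obj N)) : thickPerp D (s.obj (cokernel f)) := by
  obtain ⟨_, hf⟩ := hs.exists_triangle_image_cokernel f
  exact (thickPerp D).ext_of_isTriangulatedClosed₃ _ hf (hs.thickPerp_image D f hM hN) hN

end IsHereditaryHeart

end Heart

/-! ### Rigid and presilting objects -/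

section Rigid

attribute [local instance] Abelian.hasFiniteBiproducts

namespace IsHereditaryHeart

variable {H : Type*} [Category* H] [Abelian H]
  {C : Type*} [Category* C] [HasZeroObject C] [HasShift C ℤ] [Preadditive C]
  [∀ n : ℤ, (shiftFunctor C n).Additive] [Pretriangulated C]
  {s : H ⥤ C} (hs : IsHereditaryHeart s)

include hs

lemma prop_of_kernel_of_cokernel (P : ObjectProperty C) [P.IsTriangulated]
    [P.IsClosedUnderIsomorphisms] {X Y : H} (f : X ⟶ Y) (hX : P (s.obj X))
    (hker : P (s.obj (kernel f))) (hcoker : P (s.obj (cokernel f))) : P (s.obj Y) := by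
  obtain ⟨_, h₁⟩ := hs.exists_triangle_kernel_image f
  obtain ⟨_, h₂⟩ := hs.exists_triangle_image_cokernel f
  exact P.ext_of_isTriangulatedClosed₂ _ h₂ (P.ext_of_isTriangulatedClosed₃ _ h₁ hker hX) hcoker

lemma hom_shift_one_kernel_eq_zero [s.Full] {T X Y : H} {f : X ⟶ Y}
    (hf : IsRightApproximation T f) (hX : ∀ g : s.obj T ⟶ (s.obj X)⟦(1 : ℤ)⟧, g = 0)
    (g : s.obj T ⟶ (s.obj (kernel f))⟦(1 : ℤ)⟧) : g = 0 := by
  obtain ⟨δ, hδ⟩ := hs.exists_triangle_kernel_image f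
  obtain ⟨g', rfl⟩ : ∃ g' : s.obj T ⟶ s.obj (Abelian.image f), g = g' ≫ δ :=
    Triangle.coyoneda_exact₁ _ hδ g (hX _)
  obtain ⟨g', rfl⟩ := s.map_surjective g'
  obtain ⟨h, hh⟩ := hf (g' ≫ Abelian.image.ι f)
  obtain rfl : h ≫ Abelian.factorThruImage f = g' := by
    rw [← cancel_mono (Abelian.image.ι f), Category.assoc, Abelian.image.fac, hh]
  have hδ₀ : s.map (Abelian.factorThruImage f) ≫ δ = 0 := comp_distTriang_mor_zero₂₃ _ hδ
  rw [s.map_comp, Category.assoc, hδ₀, comp_zero]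

variable [s.Additive]

lemma exists_universal_extension (R : Type*) [Semiring R] [Linear R C] (T M : H)
    [Module.Finite R (s.obj T ⟶ (s.obj M)⟦(1 : ℤ)⟧)]
    (hTT : ∀ f : s.obj T ⟶ (s.obj T)⟦(1 : ℤ)⟧, f = 0) :
    ∃ (m : ℕ) (M' : H) (a : s.obj M ⟶ s.obj M') (b : s.obj M' ⟶ s.obj (⨁ fun _ : Fin m => T))
      (c : s.obj (⨁ fun _ : Fin m => T) ⟶ (s.obj M)⟦(1 : ℤ)⟧),
      Triangle.mk a b c ∈ distTriang C ∧
        ∀ f : s.obj T ⟶ (s.obj M')⟦(1 : ℤ)⟧, f = 0 := by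
  obtain ⟨m, c, hc⟩ := exists_isRightApproximation R s T ((s.obj M)⟦(1 : ℤ)⟧)
  obtain ⟨M', a, b, hT⟩ := hs.exists_extension c
  refine ⟨m, M', a, b, c, hT, fun f => ?_⟩
  obtain ⟨g, rfl⟩ := exists_shift_lift₂ hT f
    (hom_to_map_biproduct_eq_zero (s ⋙ shiftFunctor C (1 : ℤ)) _ (fun _ => hTT) _)
  obtain ⟨h, rfl⟩ := hc g
  have hca : c ≫ a⟦(1 : ℤ)⟧' = 0 := comp_distTriang_mor_zero₃₁ _ hT
  rw [Category.assoc, hca, comp_zero]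

variable [IsTriangulated C] [s.Full] [s.Faithful]

lemma thickPerp_cokernel_of_isRightApproximation {T X Y : H} {f : X ⟶ Y}
    (hf : IsRightApproximation T f) (hX : ∀ g : s.obj T ⟶ (s.obj X)⟦(1 : ℤ)⟧, g = 0)
    (hY : ∀ g : s.obj T ⟶ (s.obj Y)⟦(1 : ℤ)⟧, g = 0) :
    thickPerp (s.obj T) (s.obj (cokernel f)) := by
  refine (hs.thickPerp_stalk_iff _ _).2
    ⟨fun g => ?_, hs.hom_shift_one_eq_zero_of_epi (cokernel.π f) hY⟩
  obtain ⟨_, hδ⟩ := hs.exists_triangle_image_cokernel f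
  obtain ⟨g', hg'⟩ : ∃ g' : s.obj T ⟶ s.obj Y, s.map g = g' ≫ s.map (cokernel.π f) :=
    Triangle.coyoneda_exact₃ _ hδ (s.map g)
      (hs.hom_shift_one_eq_zero_of_epi (Abelian.factorThruImage f) hX _)
  obtain ⟨g', rfl⟩ := s.map_surjective g'
  obtain ⟨h, rfl⟩ := hf g'
  apply s.map_injective
  rw [hg', ← s.map_comp, Category.assoc, cokernel.condition, comp_zero]

lemma thick_image {T K : H} (hTT : ∀ f : s.obj T ⟶ (s.obj T)⟦(1 : ℤ)⟧, f = 0) {m n : ℕ}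
    (f : (⨁ fun _ : Fin m => T) ⟶ K) (i : K ⟶ ⨁ fun _ : Fin n => T) [Mono i] :
    thick (s.obj T) (s.obj (Abelian.image f)) := by
  obtain ⟨r⟩ := hs.nonempty_retract_biprod (Abelian.factorThruImage f) (Abelian.image.ι f ≫ i)
    (hom_from_map_biproduct_eq_zero s _ fun _ =>
      hom_to_map_biproduct_eq_zero (s ⋙ shiftFunctor C (1 : ℤ)) _ fun _ => hTT)
  have := preservesBinaryBiproducts_of_preservesBiproducts s
  refine (thick (s.obj T)).prop_of_retract (r.map s)
    ((thick (s.obj T)).prop_of_iso (s.mapBiprod _ _).symm ?_)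
  exact prop_biprod_of_isTriangulatedClosed₂ _ (thick_map_biproduct s T _)
    (thick_map_biproduct s T _)

variable {R : Type*} [Semiring R] [Linear R C] {T : H}
  (hTT : ∀ f : s.obj T ⟶ (s.obj T)⟦(1 : ℤ)⟧, f = 0)
  (hfin : ∀ (N : H) (n : ℤ), Module.Finite R (s.obj T ⟶ (s.obj N)⟦n⟧))

include hTT hfin

/-- `M` is resolved by `T`-approximations. The resolution stops because the image of the second
approximation is a direct summand of a sum of copies of `T`. -/
lemma prop_stalk_of_rigid (P : ObjectProperty C) [P.IsTriangulated] [P.IsClosedUnderIsomorphisms]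
    (hP : thick (s.obj T) ≤ P) (hP' : thickPerp (s.obj T) ≤ P) (M : H) : P (s.obj M) := by
  have hfin₀ (N : H) : Module.Finite R (s.obj T ⟶ s.obj N) :=
    (finite_hom_shift_zero_iff _ _).1 (hfin N 0)
  have hbip (m : ℕ) : P (s.obj (⨁ fun _ : Fin m => T)) := hP _ (thick_map_biproduct s T _)
  have hext (m : ℕ) (f : s.obj T ⟶ (s.obj (⨁ fun _ : Fin m => T))⟦(1 : ℤ)⟧) : f = 0 :=
    hom_to_map_biproduct_eq_zero (s ⋙ shiftFunctor C (1 : ℤ)) _ (fun _ => hTT) f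
  have := hfin M 1
  obtain ⟨m, M', a, b, c, hT, hM'⟩ := hs.exists_universal_extension R T M hTT
  suffices hPM' : P (s.obj M') from P.ext_of_isTriangulatedClosed₁ _ hT hPM' (hbip m)
  obtain ⟨m₀, f₀, hf₀⟩ := exists_isRightApproximation_of_full R s T M'
  obtain ⟨m₁, f₁, hf₁⟩ := exists_isRightApproximation_of_full R s T (kernel f₀)
  have hK : P (s.obj (kernel f₀)) := by
    obtain ⟨_, h⟩ := hs.exists_triangle_image_cokernel f₁
    exact P.ext_of_isTriangulatedClosed₂ _ h (hP _ (hs.thick_image hTT f₁ (kernel.ι f₀)))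
      (hP' _ (hs.thickPerp_cokernel_of_isRightApproximation hf₁ (hext m₁)
        (hs.hom_shift_one_kernel_eq_zero hf₀ (hext m₀))))
  exact hs.prop_of_kernel_of_cokernel P f₀ (hbip m₀) hK
    (hP' _ (hs.thickPerp_cokernel_of_isRightApproximation hf₀ (hext m₀) hM'))

lemma isRightAdmissible_of_rigid : IsRightAdmissible (s.obj T) := by
  have := isTriangulated_extensionProduct_thick (s.obj T)
  exact hs.eq_top (hs.prop_stalk_of_rigid hTT hfin _
    (ObjectProperty.le_extensionProduct_left _) (ObjectProperty.le_extensionProduct_right _))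

end IsHereditaryHeart

end Rigid

section Presilting

namespace IsPresilting

variable {C : Type*} [Category* C] [HasShift C ℤ] [Preadditive C]

lemma hom_eq_zero {X Y Z : C} (hZ : IsPresilting Z) (r : Retract X Z)
    (r' : Retract Y Z) {n : ℤ} (hn : 0 < n) (f : X ⟶ Y⟦n⟧) : f = 0 := by
  have h : f = r.i ≫ (r.r ≫ f ≫ r'.i⟦n⟧') ≫ r'.r⟦n⟧' := by
    simp [← Functor.map_comp]
  rw [h, hZ n hn (r.r ≫ f ≫ r'.i⟦n⟧'), zero_comp, comp_zero]

lemma of_retract {X Y : C} (hY : IsPresilting Y) (r : Retract X Y) : IsPresilting X :=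
  fun _ hn f => hY.hom_eq_zero r r hn f

lemma of_shift [∀ n : ℤ, (shiftFunctor C n).Additive] {X : C} {m : ℤ}
    (hX : IsPresilting (X⟦m⟧)) : IsPresilting X := by
  intro n hn f
  have h := hX n hn (f⟦m⟧' ≫ (shiftFunctorComm C n m).hom.app X)
  rw [Preadditive.IsIso.comp_right_eq_zero] at h
  exact (Functor.map_eq_zero_iff _).1 h

end IsPresilting

namespace IsHereditaryHeart

variable {H : Type*} [Category* H] [Abelian H]
  {C : Type*} [Category* C] [HasZeroObject C] [HasShift C ℤ] [Preadditive C]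
  [∀ n : ℤ, (shiftFunctor C n).Additive] [Pretriangulated C] [IsTriangulated C]
  {s : H ⥤ C} (hs : IsHereditaryHeart s) [s.Additive] [s.Full] [s.Faithful]
  {R : Type*} [Semiring R] [Linear R C] [∀ n : ℤ, (shiftFunctor C n).Linear R]
  {D : C} (hD : IsPresilting D)
  (hfin : ∀ (N : H) (n : ℤ), Module.Finite R (D ⟶ (s.obj N)⟦n⟧))

include hs hD hfin

theorem isRightAdmissible_of_isPresilting : IsRightAdmissible D := by
  obtain ⟨b, hb⟩ := hs.exists_heartSum D
  induction hb with
  | zero _ X hX => exact isRightAdmissible_of_isZero hX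
  | succ b X Y M hX e ih =>
    have rX : Retract X Y := (BinaryBiproduct.bicone X ((s.obj M)⟦-b⟧)).retract_left.trans
      e.symm.retract
    have rM : Retract ((s.obj M)⟦-b⟧) Y :=
      (BinaryBiproduct.bicone X ((s.obj M)⟦-b⟧)).retract_right.trans e.symm.retract
    have hM : IsRightAdmissible (s.obj M) := by
      refine hs.isRightAdmissible_of_rigid ((hD.of_retract rM).of_shift 1 one_pos)
        fun N n => (finite_hom_shift_iff (R := R) _ _ (sub_eq_add_neg n b).symm).1 ?_
      have := hfin N (n - b)
      exact finite_hom_of_retract rM _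
    have hXM : thickPerp X ((s.obj M)⟦-b⟧) := by
      refine thickPerp_iff.2 fun n f => ?_
      by_cases hn : 0 < n
      · exact hD.hom_eq_zero rX rM hn f
      · exact hom_shift_shift_eq_zero rfl (hs.heartSum_hom_eq_zero hX M (-b + n) (by lia)) f
    refine .of_thick_eq (thick_congr e.symm)
      (.biprod (ih (hD.of_retract rX) fun N n => ?_) (.of_thick_eq (thick_shift _ _).symm hM) hXM)
    have := hfin N n
    exact finite_hom_of_retract rX _

theorem eq_top_of_isPresilting (P : ObjectProperty C) [P.IsTriangulated]
    [P.IsClosedUnderIsomorphisms] (hP : thick D ≤ P)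
    (hP' : ∀ M : H, thickPerp D (s.obj M) → P (s.obj M)) : P = ⊤ := by
  have hperp : thickPerp D ≤ P := by
    intro X
    induction X using hs.induction with
    | hP e h => exact fun h' => P.prop_of_iso e (h ((thickPerp D).prop_of_iso e.symm h'))
    | hzero X hX => exact fun _ => P.prop_of_isZero hX
    | hadd X Y hX hY =>
      exact fun h => prop_biprod_of_isTriangulatedClosed₂ P
        (hX (ObjectProperty.IsStableUnderRetracts.of_biprod_left _ h))
        (hY (ObjectProperty.IsStableUnderRetracts.of_biprod_right _ h))
    | hstalk M n => exact fun h => P.le_shift n _ (hP' M ((thickPerp_shift_iff n).1 h))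
  rw [eq_top_iff, ← hs.isRightAdmissible_of_isPresilting hD hfin]
  exact ObjectProperty.extensionProduct_le_of_isTriangulatedClosed₂ hP hperp

end IsHereditaryHeart

end Presilting

/-! ### Extensions and exact embeddings -/

section Effaceable

open Abelian DerivedCategory HomologicalComplex

variable {A : Type u} [Category.{v} A] [Abelian A]

section Complex

variable {L : CochainComplex A ℤ} [L.IsStrictlyGE 0]

variable (L) in
/-- The morphism of complexes from `L`, concentrated in nonnegative degrees, to its term in
degree `0`. -/
noncomputable def toSingleZero : L ⟶ (single A (.up ℤ) 0).obj (L.X 0) :=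
  mkHomToSingle (𝟙 _) fun i hi =>
    (L.isZero_of_isStrictlyGE 0 i (by simp only [ComplexShape.up_Rel] at hi; lia)).eq_of_src _ _

lemma comp_toSingleZero_eq_zero_iff {X : A} (g : (single A (.up ℤ) 0).obj X ⟶ L) :
    g ≫ toSingleZero L = 0 ↔ g = 0 := by
  refine ⟨fun h => from_single_hom_ext ?_, fun h => by rw [h, zero_comp]⟩
  have h₀ := congr_hom h 0
  rwa [comp_f, toSingleZero, mkHomToSingle_f, Category.id_comp, zero_f,
    Preadditive.IsIso.comp_right_eq_zero] at h₀

lemma mono_of_map_eq_comp_toSingleZero [HasDerivedCategory.{w} A] {Y : A} {i : Y ⟶ L.X 0}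
    (s : (single A (.up ℤ) 0).obj Y ⟶ L) [IsIso (Q.map s)]
    (hi : (single A (.up ℤ) 0).map i = s ≫ toSingleZero L) : Mono i := by
  refine Preadditive.mono_of_cancel_zero _ fun {W} a ha => ?_
  have has : (single A (.up ℤ) 0).map a ≫ s = 0 := by
    rw [← comp_toSingleZero_eq_zero_iff, Category.assoc, ← hi, ← Functor.map_comp, ha,
      Functor.map_zero]
  have hQa : Q.map ((single A (.up ℤ) 0).map a) = 0 := by
    rw [← cancel_mono (Q.map s), ← Q.map_comp, has, Q.map_zero, zero_comp]
  apply (DerivedCategory.singleFunctor A 0).map_injective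
  rw [Functor.map_zero]
  exact hQa

end Complex

lemma exists_mono_singleFunctor_comp_eq_zero [HasDerivedCategory.{w} A] {X Y : A} {m : ℤ}
    (hm : m ≠ 0)
    (f : (DerivedCategory.singleFunctor A m).obj X ⟶ (DerivedCategory.singleFunctor A 0).obj Y) :
    ∃ (Z : A) (i : Y ⟶ Z) (_ : Mono i), f ≫ (DerivedCategory.singleFunctor A 0).map i = 0 := by
  let φ : Q.obj ((single A (.up ℤ) m).obj X) ⟶ Q.obj ((single A (.up ℤ) 0).obj Y) := f
  obtain ⟨L, _, g, s, _, hφ⟩ := left_fac_of_isStrictlyGE φ 0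
  obtain ⟨i, hi⟩ := (single A (.up ℤ) 0).map_surjective (s ≫ toSingleZero L)
  refine ⟨_, i, mono_of_map_eq_comp_toSingleZero s hi, ?_⟩
  have hg : g ≫ toSingleZero L = 0 :=
    from_single_hom_ext ((isZero_single_obj_X (.up ℤ) 0 (L.X 0) m hm).eq_of_tgt _ _)
  change φ ≫ Q.map ((single A (.up ℤ) 0).map i) = 0
  rw [hφ, hi, Q.map_comp, Category.assoc, IsIso.inv_hom_id_assoc, ← Q.map_comp, hg, Q.map_zero]

lemma ext_exists_mono_comp_eq_zero [HasExt.{w} A] {X Y : A} {n : ℕ}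
    (hn : n ≠ 0) (x : Ext X Y n) :
    ∃ (Z : A) (i : Y ⟶ Z) (_ : Mono i), x.comp (Ext.mk₀ i) (add_zero _) = 0 := by
  let := HasDerivedCategory.standard A
  let e := ((singleFunctors A).shiftIso (n : ℤ) 0 (n : ℤ) (by simp)).app X
  obtain ⟨f, hf⟩ := (shiftFunctor (DerivedCategory A) (n : ℤ)).map_surjective (e.hom ≫ x.hom)
  obtain ⟨Z, i, hi, h⟩ := exists_mono_singleFunctor_comp_eq_zero (by simpa using hn) f
  refine ⟨Z, i, hi, ?_⟩
  ext
  rw [Ext.comp_hom, Ext.mk₀_hom, ShiftedHom.comp_mk₀, Ext.zero_hom, ← cancel_epi e.hom,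
    ← Category.assoc, ← hf, ← Functor.map_comp, h, Functor.map_zero, comp_zero]

lemma ext_exists_shortExact_comp_extClass [HasExt.{w} A] {X Y : A} {n m : ℕ}
    (h : n + 1 = m) (x : Ext X Y m) :
    ∃ (Z Q : A) (i : Y ⟶ Z) (q : Z ⟶ Q) (hi : i ≫ q = 0) (hS : (ShortComplex.mk i q hi).ShortExact)
      (y : Ext X Q n), y.comp hS.extClass h = x := by
  obtain ⟨Z, i, _, hx⟩ := ext_exists_mono_comp_eq_zero (by lia) x
  have hS : (ShortComplex.mk i (cokernel.π i) (cokernel.condition i)).ShortExact :=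
    { exact := ShortComplex.exact_cokernel i }
  exact ⟨_, _, i, cokernel.π i, _, hS, Ext.covariant_sequence_exact₁ _ hS x hx h⟩

lemma exists_shortExact_pullback {X Y Z Q : A} {i : Y ⟶ Z} {q : Z ⟶ Q} {hi : i ≫ q = 0}
    (hS : (ShortComplex.mk i q hi).ShortExact) (f : X ⟶ Q) :
    ∃ (E : A) (i' : Y ⟶ E) (p : E ⟶ X) (hi' : i' ≫ p = 0)
      (_ : (ShortComplex.mk i' p hi').ShortExact)
      (φ : ShortComplex.mk i' p hi' ⟶ ShortComplex.mk i q hi), φ.τ₁ = 𝟙 Y ∧ φ.τ₃ = f := by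
  have : Mono i := hS.mono_f
  have : Epi q := hS.epi_g
  have hw : i ≫ q = 0 ≫ f := by rw [hi, zero_comp]
  let i' : Y ⟶ pullback q f := pullback.lift i 0 hw
  have hi'q : i' ≫ pullback.fst q f = i := pullback.lift_fst i 0 hw
  have hi'f : i' ≫ pullback.snd q f = 0 := pullback.lift_snd i 0 hw
  have : Mono i' := mono_of_mono_fac hi'q
  refine ⟨_, i', pullback.snd q f, hi'f, .mk (ShortComplex.exact_of_f_is_kernel _ ?_),
    { τ₁ := 𝟙 Y, τ₂ := pullback.fst q f, τ₃ := f, comm₁₂ := ?_, comm₂₃ := pullback.condition },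
    rfl, rfl⟩
  · refine KernelFork.IsLimit.ofι' _ _ fun {W} g hg => ?_
    have hg' : (g ≫ pullback.fst q f) ≫ q = 0 := by
      rw [Category.assoc, pullback.condition, reassoc_of% hg, zero_comp]
    refine ⟨hS.exact.lift _ hg', pullback.hom_ext ?_ ?_⟩
    · refine (Category.assoc _ _ _).trans ?_
      rw [hi'q]
      exact hS.exact.lift_f _ hg'
    · refine (Category.assoc _ _ _).trans ?_
      rw [hi'f, comp_zero]
      exact hg.symm
  · exact (Category.id_comp i).trans hi'q.symm

lemma exists_extClass_eq [HasExt.{w} A] {X Y : A} (x : Ext X Y 1) :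
    ∃ (E : A) (i : Y ⟶ E) (p : E ⟶ X) (hi : i ≫ p = 0) (hS : (ShortComplex.mk i p hi).ShortExact),
      hS.extClass = x := by
  obtain ⟨Z, Q, i, q, hi, hS, y, rfl⟩ := ext_exists_shortExact_comp_extClass (zero_add 1) x
  obtain ⟨f, rfl⟩ := (Ext.mk₀_bijective X Q).2 y
  obtain ⟨E, i', p, hi', hS', φ, h₁, h₃⟩ := exists_shortExact_pullback hS f
  refine ⟨E, i', p, hi', hS', ?_⟩
  have hφ := ShortComplex.ShortExact.extClass_naturality hS' hS φ
  rw [h₁, h₃] at hφ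
  exact (Ext.comp_mk₀_id _).symm.trans hφ

lemma exists_retraction_of_extClass_eq_zero [HasExt.{w} A] {X Y Z : A} {i : X ⟶ Y} {p : Y ⟶ Z}
    {hi : i ≫ p = 0} (hS : (ShortComplex.mk i p hi).ShortExact) (h : hS.extClass = 0) :
    ∃ r : Y ⟶ X, i ≫ r = 𝟙 X := by
  have h₀ : hS.extClass.comp (Ext.mk₀ (𝟙 X)) (add_zero 1) = 0 := by rw [h, Ext.zero_comp]
  obtain ⟨r, hr⟩ : ∃ r : Ext Y X 0, (Ext.mk₀ i).comp r (zero_add 0) = Ext.mk₀ (𝟙 X) :=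
    Ext.contravariant_sequence_exact₁ hS _ (Ext.mk₀ (𝟙 X)) (add_zero 1) h₀
  obtain ⟨r, rfl⟩ := (Ext.mk₀_bijective _ _).2 r
  rw [Ext.mk₀_comp_mk₀] at hr
  exact ⟨r, (Ext.mk₀_bijective _ _).1 hr⟩

lemma ext_eq_zero_of_two_le [HasExt.{w} A] (h : ∀ X Y : A, Subsingleton (Ext X Y 2)) {X Y : A}
    {n : ℕ} (hn : 2 ≤ n) (x : Ext X Y n) : x = 0 := by
  induction n, hn using Nat.le_induction generalizing Y with
  | base => exact Subsingleton.elim _ _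
  | succ n _ ih =>
    obtain ⟨Z, Q, i, q, hi, hS, y, rfl⟩ := ext_exists_shortExact_comp_extClass rfl x
    rw [ih y, Ext.zero_comp]

end Effaceable

section ExactEmbedding

open Abelian Functor

variable {A : Type*} [Category* A] [Abelian A] {B : Type*} [Category* B] [Abelian B]
  (F : A ⥤ B) [F.Additive] [PreservesFiniteLimits F] [PreservesFiniteColimits F]
  [F.Full] [F.Faithful]

lemma exists_shortExact_map_iso [F.essImage.IsClosedUnderExtensions] {X Y : A} {E : B}
    {i : F.obj Y ⟶ E} {p : E ⟶ F.obj X} {hi : i ≫ p = 0}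
    (hS : (ShortComplex.mk i p hi).ShortExact) :
    ∃ (E' : A) (i' : Y ⟶ E') (p' : E' ⟶ X) (hi' : i' ≫ p' = 0)
      (_ : (ShortComplex.mk i' p' hi').ShortExact)
      (α : (ShortComplex.mk i' p' hi').map F ≅ ShortComplex.mk i p hi),
      α.hom.τ₁ = 𝟙 _ ∧ α.hom.τ₃ = 𝟙 _ := by
  obtain ⟨E', ⟨e⟩⟩ : F.essImage E :=
    F.essImage.prop_X₂_of_shortExact hS (F.obj_mem_essImage Y) (F.obj_mem_essImage X)
  obtain ⟨i', hi'⟩ := F.map_surjective (i ≫ e.inv)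
  obtain ⟨p', hp'⟩ := F.map_surjective (e.hom ≫ p)
  have hi'e : F.map i' ≫ e.hom = i := by rw [hi', Category.assoc, e.inv_hom_id, Category.comp_id]
  have hw : i' ≫ p' = 0 := F.map_injective (by
    rw [F.map_comp, hp', reassoc_of% hi'e, hi, F.map_zero])
  let α : (ShortComplex.mk i' p' hw).map F ≅ ShortComplex.mk i p hi :=
    ShortComplex.isoMk (Iso.refl _) e (Iso.refl _) ((Category.id_comp i).trans hi'e.symm)
      (hp'.symm.trans (Category.comp_id _).symm)
  have hS₁ : ((ShortComplex.mk i' p' hw).map F).ShortExact :=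
    ShortComplex.shortExact_of_iso α.symm hS
  have : Mono i' := F.mono_of_mono_map hS₁.mono_f
  have : Epi p' := F.epi_of_epi_map hS₁.epi_g
  exact ⟨E', i', p', hw, { exact := (ShortComplex.exact_map_iff_of_faithful _ F).1 hS₁.exact }, α,
    rfl, rfl⟩

variable [HasExt.{w} A] [HasExt.{w'} B]

lemma mapExtAddHom_one_injective (X Y : A) : Function.Injective (F.mapExtAddHom X Y 1) := by
  rw [injective_iff_map_eq_zero]
  intro x hx
  obtain ⟨E, i, p, hi, hS, rfl⟩ := exists_extClass_eq x
  rw [mapExtAddHom_apply, Ext.mapExactFunctor_extClass] at hx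
  obtain ⟨r, hr⟩ : ∃ r : F.obj E ⟶ F.obj Y, F.map i ≫ r = 𝟙 (F.obj Y) :=
    exists_retraction_of_extClass_eq_zero (hS.map_of_exact F) hx
  obtain ⟨r, rfl⟩ := F.map_surjective r
  have hir : i ≫ r = 𝟙 Y := F.map_injective (by rw [F.map_comp, hr, F.map_id])
  have h : hS.extClass.comp ((Ext.mk₀ i).comp (Ext.mk₀ r) (zero_add 0)) (add_zero 1) = 0 :=
    hS.extClass_comp_assoc (Ext.mk₀ r)
  rw [Ext.mk₀_comp_mk₀, hir] at h
  exact (Ext.comp_mk₀_id _).symm.trans h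

variable [F.essImage.IsClosedUnderExtensions]

lemma mapExtAddHom_one_surjective (X Y : A) : Function.Surjective (F.mapExtAddHom X Y 1) := by
  intro y
  obtain ⟨E, i, p, hi, hS, rfl⟩ := exists_extClass_eq y
  obtain ⟨E', i', p', hi', hS', α, h₁, h₃⟩ := exists_shortExact_map_iso F hS
  refine ⟨hS'.extClass, ?_⟩
  have hα := ShortComplex.ShortExact.extClass_naturality (hS'.map_of_exact F) hS α.hom
  rw [h₁, h₃] at hα
  rw [mapExtAddHom_apply, Ext.mapExactFunctor_extClass]
  exact (Ext.comp_mk₀_id _).symm.trans (hα.trans (Ext.mk₀_id_comp _))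

include F in
lemma subsingleton_ext_two (hB : ∀ X Y : B, Subsingleton (Ext X Y 2)) (X Y : A) :
    Subsingleton (Ext X Y 2) := by
  refine subsingleton_of_forall_eq 0 fun x => ?_
  obtain ⟨Z, Q, i, q, hi, hS, y, rfl⟩ := ext_exists_shortExact_comp_extClass (n := 1) rfl x
  obtain ⟨z, hz⟩ := Ext.covariant_sequence_exact₃ _ (hS.map_of_exact F) (y.mapExactFunctor F)
    (n₁ := 2) rfl (Subsingleton.elim _ _)
  obtain ⟨z, rfl⟩ := mapExtAddHom_one_surjective F X Z z
  obtain rfl : z.comp (Ext.mk₀ q) (add_zero 1) = y := by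
    apply mapExtAddHom_one_injective F
    rw [mapExtAddHom_apply, Ext.mapExactFunctor_comp, Ext.mapExactFunctor_mk₀]
    exact hz
  calc (z.comp (Ext.mk₀ q) (add_zero 1)).comp hS.extClass rfl
    _ = z.comp ((Ext.mk₀ q).comp hS.extClass (zero_add 1)) rfl :=
      Ext.comp_assoc_of_second_deg_zero _ _ _ _
    _ = 0 := (congrArg (z.comp · _) hS.comp_extClass).trans (Ext.comp_zero _ _ _ _ _)

lemma mapExtAddHom_bijective (hB : ∀ X Y : B, Subsingleton (Ext X Y 2)) (X Y : A) (n : ℕ) :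
    Function.Bijective (F.mapExtAddHom X Y n) := by
  match n with
  | 0 =>
    have h : F.mapExtAddHom X Y 0 ∘ Ext.mk₀ = Ext.mk₀ ∘ F.map :=
      funext fun f => Ext.mapExactFunctor_mk₀ F f
    rw [← Function.Bijective.of_comp_iff _ (Ext.mk₀_bijective X Y), h]
    exact (Ext.mk₀_bijective _ _).comp ⟨F.map_injective, F.map_surjective⟩
  | 1 => exact ⟨mapExtAddHom_one_injective F X Y, mapExtAddHom_one_surjective F X Y⟩
  | n + 2 =>
    have hA := subsingleton_ext_two F hB
    have hn : 2 ≤ n + 2 := Nat.le_add_left 2 n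
    exact ⟨fun x y _ => (ext_eq_zero_of_two_le hA hn x).trans (ext_eq_zero_of_two_le hA hn y).symm,
      fun y => ⟨0, (map_zero _).trans (ext_eq_zero_of_two_le hB hn y).symm⟩⟩

end ExactEmbedding

/-! ### Stalks in the bounded derived category -/

section BoundedStalk

open DerivedCategory DerivedCategory.TStructure

variable {H : Type u} [Category.{v} H] [Abelian H] [HasDerivedCategory.{w} H]

variable (H) in
/-- The inclusion of an abelian category in its bounded derived category, as complexes concentrated
in degree `0`. -/
noncomputable def boundedStalkFunctor : H ⥤ Bounded H :=
  t.bounded.lift (singleFunctor H 0) fun M => (boundedStalk M).property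

variable (H) in
/-- The stalk functor, followed by the inclusion in the unbounded derived category. -/
noncomputable def boundedStalkFunctorCompι :
    boundedStalkFunctor H ⋙ Bounded.ι ≅ singleFunctor H 0 :=
  t.bounded.liftCompιIso _ _

instance : (boundedStalkFunctor H).Full :=
  Functor.Full.of_comp_faithful_iso (boundedStalkFunctorCompι H)

instance : (boundedStalkFunctor H).Faithful :=
  Functor.Faithful.of_comp_iso (boundedStalkFunctorCompι H)

instance : (boundedStalkFunctor H).Additive where
  map_add {_ _ _ _} := Bounded.ι.map_injective ((singleFunctor H 0).map_add)

instance (M : H) : t.IsLE ((boundedStalkFunctor H).obj M).obj 0 :=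
  inferInstanceAs (t.IsLE ((singleFunctor H 0).obj M) 0)

instance (M : H) : t.IsGE ((boundedStalkFunctor H).obj M).obj 0 :=
  inferInstanceAs (t.IsGE ((singleFunctor H 0).obj M) 0)

/-- Morphisms to a shift in the bounded derived category, computed in the derived category. -/
noncomputable def homShiftAddEquiv (X Y : Bounded H) (n : ℤ) :
    (X ⟶ Y⟦n⟧) ≃+ (X.obj ⟶ Y.obj⟦n⟧) :=
  AddEquiv.mk' (t.bounded.fullyFaithfulι.homEquiv.trans
    ((Bounded.ι.commShiftIso n).app Y).homToEquiv) fun f g => by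
      change Bounded.ι.map (f + g) ≫ _ = Bounded.ι.map f ≫ _ + Bounded.ι.map g ≫ _
      rw [Functor.map_add, Preadditive.add_comp]

lemma boundedStalk_hom_eq_zero_of_neg (X Y : H) {n : ℤ} (hn : n < 0)
    (f : (boundedStalkFunctor H).obj X ⟶ ((boundedStalkFunctor H).obj Y)⟦n⟧) : f = 0 := by
  apply (homShiftAddEquiv _ _ n).injective
  have : t.IsGE (((boundedStalkFunctor H).obj Y).obj⟦n⟧) (-n) := t.isGE_shift _ 0 n (-n)
  rw [map_zero]
  exact t.zero _ 0 (-n) (by lia)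

lemma boundedStalk_hom_eq_zero_of_two_le [HasExt.{w'} H]
    (h : ∀ X Y : H, Subsingleton (Abelian.Ext X Y 2)) (X Y : H) {n : ℤ} (hn : 2 ≤ n)
    (f : (boundedStalkFunctor H).obj X ⟶ ((boundedStalkFunctor H).obj Y)⟦n⟧) : f = 0 := by
  apply (homShiftAddEquiv _ _ n).injective
  obtain ⟨n, rfl⟩ := Int.eq_ofNat_of_zero_le (show 0 ≤ n by lia)
  obtain ⟨x, hx⟩ := (Abelian.Ext.homEquiv (X := X) (Y := Y) (n := n)).surjective
    (homShiftAddEquiv _ _ (n : ℤ) f)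
  rw [map_zero, ← hx, ext_eq_zero_of_two_le h (by lia) x]
  exact Abelian.Ext.zero_hom _ _ _

lemma boundedStalk_triangle_distinguished {S : ShortComplex H} (hS : S.ShortExact) :
    Triangle.mk ((boundedStalkFunctor H).map S.f) ((boundedStalkFunctor H).map S.g)
      ((homShiftAddEquiv ((boundedStalkFunctor H).obj S.X₃) ((boundedStalkFunctor H).obj S.X₁)
        1).symm hS.singleδ) ∈ distTriang (Bounded H) := by
  change Bounded.ι.mapTriangle.obj _ ∈ distTriang (DerivedCategory H)
  refine isomorphic_distinguished _ hS.singleTriangle_distinguished _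
    (Triangle.isoMk _ _ (Iso.refl _) (Iso.refl _) (Iso.refl _) ?_ ?_ ?_)
  · exact (Category.comp_id _).trans (Category.id_comp _).symm
  · exact (Category.comp_id _).trans (Category.id_comp _).symm
  · refine ((congrArg (_ ≫ ·) (CategoryTheory.Functor.map_id _ _)).trans
      (Category.comp_id _)).trans (Eq.trans ?_ (Category.id_comp _).symm)
    exact (homShiftAddEquiv ((boundedStalkFunctor H).obj S.X₃)
      ((boundedStalkFunctor H).obj S.X₁) 1).apply_symm_apply hS.singleδ

lemma boundedStalk_exists_extension {X Z : H}
    (c : (boundedStalkFunctor H).obj Z ⟶ ((boundedStalkFunctor H).obj X)⟦(1 : ℤ)⟧) :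
    ∃ (Y : H) (a : (boundedStalkFunctor H).obj X ⟶ (boundedStalkFunctor H).obj Y)
      (b : (boundedStalkFunctor H).obj Y ⟶ (boundedStalkFunctor H).obj Z),
      Triangle.mk a b c ∈ distTriang (Bounded H) := by
  have := HasExt.standard H
  obtain ⟨x, hx⟩ := (Abelian.Ext.homEquiv (X := Z) (Y := X) (n := 1)).surjective
    (homShiftAddEquiv _ _ 1 c)
  obtain ⟨Y, i, p, hi, hS, rfl⟩ := exists_extClass_eq x
  have hc : (homShiftAddEquiv _ _ 1).symm hS.singleδ = c :=
    (AddEquiv.symm_apply_eq _).2 (hS.extClass_hom.symm.trans hx)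
  exact ⟨Y, _, _, hc ▸ boundedStalk_triangle_distinguished hS⟩

lemma exists_iso_boundedStalk (X : Bounded H) (n : ℤ) [X.obj.IsGE n] [X.obj.IsLE n] :
    ∃ M : H, Nonempty (X ≅ ((boundedStalkFunctor H).obj M)⟦-n⟧) := by
  obtain ⟨M, ⟨e⟩⟩ := exists_iso_singleFunctor_obj_of_isGE_of_isLE X.obj n
  refine ⟨M, ⟨t.bounded.fullyFaithfulι.preimageIso (e ≪≫ ?_)⟩⟩
  exact ((singleFunctors H).shiftIso (-n) n 0 (by lia)).symm.app M ≪≫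
    ((Bounded.ι.commShiftIso (-n)).app (boundedStalk M)).symm

lemma heartSum_boundedStalkFunctor [HasExt.{w'} H]
    (h : ∀ X Y : H, Subsingleton (Abelian.Ext X Y 2)) (a : ℤ) (n : ℕ) (X : Bounded H)
    [t.onBounded.IsGE X a] [t.onBounded.IsLE X (a + n - 1)] :
    HeartSum (boundedStalkFunctor H) (a + n) X := by
  induction n generalizing X with
  | zero => exact .zero _ _ (t.onBounded.isZero X (a + (0 : ℕ) - 1) a (by lia))
  | succ n ih =>
    let Y := (t.onBounded.truncLT (a + n)).obj X
    let Z := (t.onBounded.truncGE (a + n)).obj X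
    let δ : Z ⟶ Y⟦(1 : ℤ)⟧ := (t.onBounded.truncGEδLT (a + n)).app X
    have : t.onBounded.IsLE X (a + n) := t.onBounded.isLE_of_le X (a + (n + 1 : ℕ) - 1) (a + n)
    have hY : HeartSum (boundedStalkFunctor H) (a + n) Y := ih Y
    have : Z.obj.IsGE (a + n) := (t.bounded.tStructure_isGE_iff t Z _).1
      (inferInstanceAs (t.onBounded.IsGE ((t.onBounded.truncGE (a + n)).obj X) (a + n)))
    have : Z.obj.IsLE (a + n) := (t.bounded.tStructure_isLE_iff t Z _).1
      (inferInstanceAs (t.onBounded.IsLE ((t.onBounded.truncGE (a + n)).obj X) (a + n)))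
    obtain ⟨M, ⟨e⟩⟩ := exists_iso_boundedStalk Z (a + n)
    have hδ : δ = 0 := by
      rw [← cancel_epi e.inv, comp_zero]
      exact hY.hom_shift_eq_zero
        (fun X Y n hn f => boundedStalk_hom_eq_zero_of_two_le h X Y hn f) M _ le_rfl _
    obtain ⟨e', -⟩ := exists_iso_binaryBiproduct_of_distTriang _
      (t.onBounded.triangleLTGE_distinguished (a + n) X) hδ
    have hX := HeartSum.succ (a + n) Y X M hY (e' ≪≫ biprod.mapIso (Iso.refl Y) e)
    rwa [add_assoc] at hX

theorem isHereditaryHeart_boundedStalkFunctor [HasExt.{w'} H]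
    (h : ∀ X Y : H, Subsingleton (Abelian.Ext X Y 2)) :
    IsHereditaryHeart (boundedStalkFunctor H) where
  exists_triangle S hS := ⟨_, boundedStalk_triangle_distinguished hS⟩
  hom_eq_zero X Y n hn f := hn.elim (fun hn => boundedStalk_hom_eq_zero_of_neg X Y hn f)
    fun hn => boundedStalk_hom_eq_zero_of_two_le h X Y hn f
  exists_extension c := boundedStalk_exists_extension c
  exists_heartSum X := by
    obtain ⟨⟨a, ha⟩, ⟨b, hb⟩⟩ := X.property
    have := (t.bounded.tStructure_isGE_iff t X a).2 ha
    have := (t.bounded.tStructure_isLE_iff t X b).2 hb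
    have := t.onBounded.isLE_of_le X b (a + (b - a + 1).toNat - 1)
    exact ⟨_, heartSum_boundedStalkFunctor h a (b - a + 1).toNat X⟩

end BoundedStalk

section BoundedLinear

open DerivedCategory DerivedCategory.TStructure

variable (R : Type t) [Ring R] {H : Type u} [Category.{v} H] [Abelian H] [Linear R H]
  [HasDerivedCategory.{w} H]

instance (n : ℤ) : (shiftFunctor (Bounded H) n).Linear R where
  map_smul f r := Bounded.ι.map_injective (by
    rw [← cancel_mono ((Bounded.ι.commShiftIso n).hom.app _), Functor.map_smul Bounded.ι,
      Linear.smul_comp, Functor.commShiftIso_hom_naturality, Functor.commShiftIso_hom_naturality,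
      Functor.map_smul, Functor.map_smul, Linear.comp_smul])

instance : (boundedStalkFunctor H).Linear R where
  map_smul f r := Bounded.ι.map_injective ((singleFunctor H 0).map_smul r f)

/-- Morphisms to a shift in the bounded derived category, computed in the derived category. -/
noncomputable def homShiftLinearEquiv (X Y : Bounded H) (n : ℤ) :
    (X ⟶ Y⟦n⟧) ≃ₗ[R] (X.obj ⟶ Y.obj⟦n⟧) :=
  { homShiftAddEquiv X Y n with
    map_smul' := fun r f => by
      change Bounded.ι.map (r • f) ≫ _ = r • Bounded.ι.map f ≫ _
      rw [Functor.map_smul, Linear.smul_comp] }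

end BoundedLinear

namespace IsHereditaryAbelian

open DerivedCategory

variable {k : Type t} [Field k] {H : Type u} [Category.{v} H] [Abelian H] [Linear k H]
  [HasDerivedCategory.{w} H] (hH : IsHereditaryAbelian k H)

include hH

lemma finite_boundedStalk_hom (M N : H) (n : ℤ) :
    Module.Finite k ((boundedStalkFunctor H).obj M ⟶ ((boundedStalkFunctor H).obj N)⟦n⟧) := by
  have := HasExt.standard H
  have hs : IsHereditaryHeart (boundedStalkFunctor H) :=
    isHereditaryHeart_boundedStalkFunctor hH.ext_two
  obtain rfl | rfl | hn : n = 0 ∨ n = 1 ∨ n < 0 ∨ 2 ≤ n := by lia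
  · have := hH.hom_finite M N
    rw [finite_hom_shift_zero_iff]
    exact Module.Finite.of_surjective ((boundedStalkFunctor H).mapLinearMap k)
      (boundedStalkFunctor H).map_surjective
  · have := hH.ext_finite M N
    exact Module.Finite.equiv
      ((Abelian.Ext.homLinearEquiv (R := k) (X := M) (Y := N) (n := 1)).trans
        (homShiftLinearEquiv k ((boundedStalkFunctor H).obj M) ((boundedStalkFunctor H).obj N)
          1).symm)
  · have := subsingleton_of_forall_eq 0 (hs.hom_eq_zero M N n hn)
    infer_instance

lemma finite_hom (X : Bounded H) (N : H) (n : ℤ) :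
    Module.Finite k (X ⟶ ((boundedStalkFunctor H).obj N)⟦n⟧) := by
  have := HasExt.standard H
  have hs : IsHereditaryHeart (boundedStalkFunctor H) :=
    isHereditaryHeart_boundedStalkFunctor hH.ext_two
  induction X using hs.induction with
  | hP e h => exact Module.Finite.equiv (Linear.homCongr k e (Iso.refl _))
  | hzero X hX =>
    have : Subsingleton (X ⟶ ((boundedStalkFunctor H).obj N)⟦n⟧) := ⟨hX.eq_of_src⟩
    infer_instance
  | hadd X Y hX hY => exact finite_hom_biprod X Y _
  | hstalk M m =>
    rw [finite_hom_shift_iff (c := n - m) _ _ (by lia)]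
    exact hH.finite_boundedStalk_hom M N (n - m)

end IsHereditaryAbelian

/-! ### Fully faithfulness of derived functors -/

section MapBijective

variable {C : Type*} [Category* C] {C' : Type*} [Category* C']

/-- `MapBijective G X Y` says that `G` induces a bijection on morphisms from `X` to `Y`. -/
def MapBijective (G : C ⥤ C') (X Y : C) : Prop :=
  Function.Bijective (G.map : (X ⟶ Y) → (G.obj X ⟶ G.obj Y))

variable {G : C ⥤ C'}

namespace MapBijective

lemma of_iso {X X' Y Y' : C} (h : MapBijective G X Y) (e : X ≅ X') (e' : Y ≅ Y') :
    MapBijective G X' Y' := by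
  have : (G.map : (X' ⟶ Y') → _) = ((G.mapIso e).homCongr (G.mapIso e')) ∘ G.map ∘
      (e.homCongr e').symm := by
    ext f
    simp [← Functor.map_comp]
  rw [MapBijective, this]
  exact (Equiv.bijective _).comp (h.comp (Equiv.bijective _))

section Shift

variable [HasShift C ℤ] [HasShift C' ℤ] [G.CommShift ℤ]

lemma shift {X Y : C} (h : MapBijective G X Y) (n : ℤ) :
    MapBijective G (X⟦n⟧) (Y⟦n⟧) := by
  have : (G.map : (X⟦n⟧ ⟶ Y⟦n⟧) → _) ∘ (shiftFunctor C n).map =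
      (((G.commShiftIso n).app X).symm.homCongr ((G.commShiftIso n).app Y).symm) ∘
        (shiftFunctor C' n).map ∘ G.map := by
    ext f
    simp
  have h' : Function.Bijective ((shiftFunctor C n).map : (X ⟶ Y) → _) :=
    Functor.FullyFaithful.map_bijective (.ofFullyFaithful _) X Y
  rw [MapBijective, ← Function.Bijective.of_comp_iff _ h', this]
  exact (Equiv.bijective _).comp
    ((Functor.FullyFaithful.map_bijective (.ofFullyFaithful _) _ _).comp h)

lemma shift_shift {X Y : C} {a b c : ℤ} (hc : c + a = b)
    (h : MapBijective G X (Y⟦c⟧)) : MapBijective G (X⟦a⟧) (Y⟦b⟧) :=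
  (h.shift a).of_iso (Iso.refl _) ((shiftFunctorAdd' C c a b hc).app Y).symm

end Shift

variable [Preadditive C] [Preadditive C'] [G.Additive]

lemma of_isZero_left {X : C} (hX : IsZero X) (Y : C) : MapBijective G X Y :=
  ⟨fun _ _ _ => hX.eq_of_src _ _, fun _ => ⟨0, (G.map_isZero hX).eq_of_src _ _⟩⟩

lemma of_isZero_right (X : C) {Y : C} (hY : IsZero Y) : MapBijective G X Y :=
  ⟨fun _ _ _ => hY.eq_of_tgt _ _, fun _ => ⟨0, (G.map_isZero hY).eq_of_tgt _ _⟩⟩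

variable [HasBinaryBiproducts C]

lemma biprod_left {X X' Y : C} (h : MapBijective G X Y) (h' : MapBijective G X' Y) :
    MapBijective G (X ⊞ X') Y := by
  refine ⟨fun f g hfg => ?_, fun f => ?_⟩
  · ext
    · exact h.1 (by rw [G.map_comp, hfg, G.map_comp])
    · exact h'.1 (by rw [G.map_comp, hfg, G.map_comp])
  · obtain ⟨a, ha⟩ := h.2 (G.map biprod.inl ≫ f)
    obtain ⟨b, hb⟩ := h'.2 (G.map biprod.inr ≫ f)
    refine ⟨biprod.fst ≫ a + biprod.snd ≫ b, ?_⟩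
    rw [G.map_add, G.map_comp, G.map_comp, ha, hb, ← Category.assoc, ← Category.assoc,
      ← Preadditive.add_comp, ← G.map_comp, ← G.map_comp, ← G.map_add, biprod.total]
    simp

lemma biprod_right {X Y Y' : C} (h : MapBijective G X Y) (h' : MapBijective G X Y') :
    MapBijective G X (Y ⊞ Y') := by
  refine ⟨fun f g hfg => ?_, fun f => ?_⟩
  · ext
    · exact h.1 (by rw [G.map_comp, hfg, G.map_comp])
    · exact h'.1 (by rw [G.map_comp, hfg, G.map_comp])
  · obtain ⟨a, ha⟩ := h.2 (f ≫ G.map biprod.fst)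
    obtain ⟨b, hb⟩ := h'.2 (f ≫ G.map biprod.snd)
    refine ⟨a ≫ biprod.inl + b ≫ biprod.inr, ?_⟩
    rw [G.map_add, G.map_comp, G.map_comp, ha, hb, Category.assoc, Category.assoc,
      ← Preadditive.comp_add, ← G.map_comp, ← G.map_comp, ← G.map_add, biprod.total]
    simp

end MapBijective

lemma IsHereditaryHeart.mapBijective {H : Type*} [Category* H] [Abelian H] [HasZeroObject C]
    [Preadditive C] [HasShift C ℤ] [∀ n : ℤ, (shiftFunctor C n).Additive] [Pretriangulated C]
    {s : H ⥤ C} (hs : IsHereditaryHeart s) [Preadditive C'] [HasShift C' ℤ] [G.CommShift ℤ]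
    [G.Additive] (hG : ∀ (M N : H) (n : ℤ), MapBijective G (s.obj M) ((s.obj N)⟦n⟧)) (X Y : C) :
    MapBijective G X Y := by
  refine hs.induction (P := fun X => MapBijective G X Y) (fun e h => h.of_iso e (Iso.refl _))
    (fun X hX => .of_isZero_left hX Y) (fun X X' h h' => h.biprod_left h') (fun M a => ?_) X
  refine hs.induction (P := fun Y => MapBijective G ((s.obj M)⟦a⟧) Y)
    (fun e h => h.of_iso (Iso.refl _) e) (fun Y hY => .of_isZero_right _ hY)
    (fun Y Y' h h' => h.biprod_right h') (fun N b => ?_) Y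
  exact (hG M N (b - a)).shift_shift (by lia)

end MapBijective

section ExactFunctor

open DerivedCategory DerivedCategory.TStructure

variable {A : Type*} [Category* A] [Abelian A] [HasDerivedCategory.{w} A]
  {B : Type*} [Category* B] [Abelian B] [HasDerivedCategory.{w'} B]
  (F : A ⥤ B) [F.Additive] [PreservesFiniteLimits F] [PreservesFiniteColimits F]

instance mapDerivedCategory_isLE (X : DerivedCategory A) (n : ℤ) [X.IsLE n] :
    (F.mapDerivedCategory.obj X).IsLE n := by
  obtain ⟨K, _, ⟨e⟩⟩ := X.exists_iso_Q_obj_of_isLE n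
  have : t.IsLE ((F.mapHomologicalComplex (.up ℤ) ⋙ Q).obj K) n :=
    inferInstanceAs ((Q.obj ((F.mapHomologicalComplex (.up ℤ)).obj K)).IsLE n)
  exact t.isLE_of_iso (F.mapDerivedCategory.mapIso e ≪≫ F.mapDerivedCategoryFactors.app K).symm n

instance mapDerivedCategory_isGE (X : DerivedCategory A) (n : ℤ) [X.IsGE n] :
    (F.mapDerivedCategory.obj X).IsGE n := by
  obtain ⟨K, _, ⟨e⟩⟩ := X.exists_iso_Q_obj_of_isGE n
  have : t.IsGE ((F.mapHomologicalComplex (.up ℤ) ⋙ Q).obj K) n :=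
    inferInstanceAs ((Q.obj ((F.mapHomologicalComplex (.up ℤ)).obj K)).IsGE n)
  exact t.isGE_of_iso (F.mapDerivedCategory.mapIso e ≪≫ F.mapDerivedCategoryFactors.app K).symm n

/-- The functor between bounded derived categories induced by an exact functor. -/
noncomputable def mapBounded : Bounded A ⥤ Bounded B :=
  t.bounded.lift (Bounded.ι ⋙ F.mapDerivedCategory) fun ⟨X, ⟨a, _⟩, ⟨b, _⟩⟩ =>
    ⟨⟨a, mapDerivedCategory_isGE F X a⟩, ⟨b, mapDerivedCategory_isLE F X b⟩⟩

noncomputable instance : (mapBounded F).CommShift ℤ :=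
  inferInstanceAs ((t.bounded.lift _ _).CommShift ℤ)

instance : (mapBounded F).IsTriangulated :=
  inferInstanceAs (t.bounded.lift _ _).IsTriangulated

instance (R : Type*) [Ring R] [Linear R A] [Linear R B] [F.Linear R] : (mapBounded F).Linear R where
  map_smul f r := Bounded.ι.map_injective ((Bounded.ι ⋙ F.mapDerivedCategory).map_smul r f)

/-- The functor induced on bounded derived categories extends the given functor. -/
noncomputable def boundedStalkFunctorCompMapBounded :
    boundedStalkFunctor A ⋙ mapBounded F ≅ F ⋙ boundedStalkFunctor B :=
  t.bounded.fullyFaithfulι.whiskeringRight A |>.preimageIso (F.mapDerivedCategorySingleFunctor 0)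

lemma mapBijective_mapBounded_iff {X Y : Bounded A} :
    MapBijective (mapBounded F) X Y ↔ MapBijective F.mapDerivedCategory X.obj Y.obj :=
  calc MapBijective (mapBounded F) X Y
    _ ↔ MapBijective (mapBounded F ⋙ Bounded.ι) X Y :=
      (Function.Bijective.of_comp_iff' (t.bounded.fullyFaithfulι.map_bijective _ _)
        (mapBounded F).map).symm
    _ ↔ MapBijective F.mapDerivedCategory X.obj Y.obj :=
      Function.Bijective.of_comp_iff (F.mapDerivedCategory.map : (X.obj ⟶ Y.obj) → _)
        (t.bounded.fullyFaithfulι.map_bijective X Y)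

lemma mapBijective_singleFunctor_of_mapExtAddHom_bijective [HasExt.{t} A] [HasExt.{u} B] {M N : A}
    {n : ℕ} (h : Function.Bijective (F.mapExtAddHom M N n)) :
    MapBijective F.mapDerivedCategory ((singleFunctor A 0).obj M)
      (((singleFunctor A 0).obj N)⟦(n : ℤ)⟧) := by
  let e := ((F.mapDerivedCategorySingleFunctor 0).app M).homCongr
    ((F.mapDerivedCategory.commShiftIso (n : ℤ)).app ((singleFunctor A 0).obj N) ≪≫
      (shiftFunctor _ (n : ℤ)).mapIso ((F.mapDerivedCategorySingleFunctor 0).app N))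
  have he : e ∘ F.mapDerivedCategory.map ∘ Abelian.Ext.homEquiv (X := M) (Y := N) (n := n) =
      Abelian.Ext.homEquiv ∘ F.mapExtAddHom M N n := by
    ext x
    refine Eq.trans ?_ (x.mapExactFunctor_hom F).symm
    simp [e, ShiftedHom.map, Abelian.Ext.hom]
  rw [MapBijective, ← Function.Bijective.of_comp_iff _ (Equiv.bijective Abelian.Ext.homEquiv),
    ← Function.Bijective.of_comp_iff' e.bijective, he]
  exact (Equiv.bijective _).comp h

lemma mapBijective_singleFunctor_of_neg (M N : A) {n : ℤ} (hn : n < 0) :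
    MapBijective F.mapDerivedCategory ((singleFunctor A 0).obj M)
      (((singleFunctor A 0).obj N)⟦n⟧) := by
  have : t.IsGE (((singleFunctor A 0).obj N)⟦n⟧) (-n) := t.isGE_shift _ 0 n (-n)
  exact ⟨fun _ _ _ => (t.zero _ 0 (-n) (by lia)).trans (t.zero _ 0 (-n) (by lia)).symm,
    fun _ => ⟨0, (F.mapDerivedCategory.map_zero _ _).trans (t.zero _ 0 (-n) (by lia)).symm⟩⟩

lemma mapBijective_mapBounded [HasExt.{t} A] [HasExt.{u} B]
    (hA : ∀ X Y : A, Subsingleton (Abelian.Ext X Y 2))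
    (hF : ∀ (M N : A) (n : ℕ), Function.Bijective (F.mapExtAddHom M N n)) (X Y : Bounded A) :
    MapBijective (mapBounded F) X Y := by
  refine (isHereditaryHeart_boundedStalkFunctor hA).mapBijective (fun M N n => ?_) X Y
  suffices h : MapBijective F.mapDerivedCategory ((singleFunctor A 0).obj M)
      (((singleFunctor A 0).obj N)⟦n⟧) from (mapBijective_mapBounded_iff F).2
    (h.of_iso (Iso.refl _) ((Bounded.ι.commShiftIso n).app (boundedStalk N)).symm)
  obtain hn | hn := lt_or_ge n 0
  · exact mapBijective_singleFunctor_of_neg F M N hn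
  · obtain ⟨n, rfl⟩ := Int.eq_ofNat_of_zero_le hn
    exact mapBijective_singleFunctor_of_mapExtAddHom_bijective F (hF M N n)

end ExactFunctor

/-! ### The perpendicular category and the Verdier quotient -/

section FullSubcategory

variable {H : Type u} [Category.{v} H] [Abelian H] (P : ObjectProperty H)

instance [P.IsClosedUnderIsomorphisms] [P.IsClosedUnderExtensions] :
    P.ι.essImage.IsClosedUnderExtensions where
  prop_X₂_of_shortExact {S} hS := by
    rintro ⟨X, ⟨e⟩⟩ ⟨Z, ⟨e'⟩⟩
    have hS₂ : P S.X₂ := P.prop_X₂_of_shortExact hS (P.prop_of_iso e X.property)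
      (P.prop_of_iso e' Z.property)
    exact P.ι.obj_mem_essImage ⟨S.X₂, hS₂⟩

variable [P.ContainsZero] [P.IsClosedUnderFiniteProducts] [P.IsClosedUnderKernels]
  [P.IsClosedUnderCokernels]

instance : PreservesFiniteLimits P.ι := by
  have := P.preservesKernels_ι
  exact P.ι.preservesFiniteLimits_of_preservesKernels

instance : PreservesFiniteColimits P.ι := by
  have := P.preservesCokernels_ι
  exact P.ι.preservesFiniteColimits_of_preservesCokernels

lemma IsHereditaryAbelian.fullSubcategory {k : Type t} [Field k] [Linear k H]
    (hH : IsHereditaryAbelian k H)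
    (hP : ∀ [HasExt.{max u v} H] [HasExt.{max u v} P.FullSubcategory] (X Y : P.FullSubcategory)
      (n : ℕ), Function.Bijective (P.ι.mapExtAddHom X Y n)) :
    IsHereditaryAbelian k P.FullSubcategory := by
  have := HasExt.standard H
  have := HasExt.standard P.FullSubcategory
  refine ⟨fun X Y => ?_, fun X Y => ?_, fun X Y => ?_⟩
  · have : Module.Finite k (P.ι.obj X ⟶ P.ι.obj Y) := hH.hom_finite X.obj Y.obj
    exact Module.Finite.of_injective (P.ι.mapLinearMap k) P.ι.map_injective
  · have : Module.Finite k (Abelian.Ext (P.ι.obj X) (P.ι.obj Y) 1) := hH.ext_finite X.obj Y.obj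
    exact Module.Finite.of_injective (P.ι.mapExtLinearMap k X Y 1) (hP X Y 1).injective
  · have : Subsingleton (Abelian.Ext (P.ι.obj X) (P.ι.obj Y) 2) := hH.ext_two X.obj Y.obj
    exact (hP X Y 2).injective.subsingleton

end FullSubcategory

section Perp

open DerivedCategory

variable {H : Type u} [Category.{v} H] [Abelian H] [HasDerivedCategory.{w} H] (D : Bounded H)

lemma perpZ_iff {M : H} : perpZ D M ↔ thickPerp D ((boundedStalkFunctor H).obj M) :=
  thickPerp_iff.symm

instance : (perpZ D).IsClosedUnderIsomorphisms where
  of_iso e h := by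
    rw [perpZ_iff] at h ⊢
    exact (thickPerp D).prop_of_iso ((boundedStalkFunctor H).mapIso e) h

instance : (perpZ D).IsClosedUnderFiniteProducts where
  isClosedUnderLimitsOfShape J _ := ⟨by
    rintro X ⟨p⟩
    rw [perpZ_iff]
    exact (thickPerp D).prop_of_isLimit (isLimitOfPreserves (boundedStalkFunctor H) p.isLimit)
      fun j => (perpZ_iff D).1 (p.prop_diag_obj j)⟩

instance : (perpZ D).ContainsZero where
  exists_zero := ⟨_, isZero_zero H, (perpZ_iff D).2
    ((thickPerp D).prop_of_isZero ((boundedStalkFunctor H).map_isZero (isZero_zero H)))⟩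

variable (hs : IsHereditaryHeart (boundedStalkFunctor H))

include hs

lemma isClosedUnderKernels_perpZ : (perpZ D).IsClosedUnderKernels where
  kernels_le := by
    rintro _ ⟨f, c, hc, hf₁, hf₂⟩
    refine (perpZ D).prop_of_iso ((limit.isLimit _).conePointUniqueUpToIso hc) ?_
    rw [perpZ_iff] at *
    exact hs.thickPerp_kernel D f hf₁ hf₂

lemma isClosedUnderCokernels_perpZ : (perpZ D).IsClosedUnderCokernels where
  cokernels_le := by
    rintro _ ⟨f, c, hc, hf₁, hf₂⟩
    refine (perpZ D).prop_of_iso ((colimit.isColimit _).coconePointUniqueUpToIso hc) ?_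
    rw [perpZ_iff] at *
    exact hs.thickPerp_cokernel D f hf₁ hf₂

lemma isClosedUnderExtensions_perpZ : (perpZ D).IsClosedUnderExtensions where
  prop_X₂_of_shortExact hS h₁ h₃ := by
    rw [perpZ_iff] at *
    exact hs.thickPerp_extension D hS h₁ h₃

end Perp

section VerdierQuotient

open ZeroObject in
lemma isZero_obj_of_isLocalization_trW {C : Type*} [Category* C] [HasZeroObject C] [HasShift C ℤ]
    [Preadditive C] [∀ n : ℤ, (shiftFunctor C n).Additive] [Pretriangulated C] {E : Type*}
    [Category* E] [Preadditive E] (P : ObjectProperty C) (L : C ⥤ E) [L.IsLocalization P.trW]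
    [L.Additive] {X : C} (hX : P X) : IsZero (L.obj X) := by
  have h : P.trW (0 : 0 ⟶ X) := ObjectProperty.trW.mk P (contractible_distinguished₁ X) hX
  have := Localization.inverts L P.trW _ h
  exact (L.map_isZero (isZero_zero C)).of_iso (asIso (L.map (0 : 0 ⟶ X))).symm

open DerivedCategory

variable {H : Type u} [Category.{v} H] [Abelian H] [HasDerivedCategory.{w} H] (D : Bounded H)
  [(perpZ D).IsClosedUnderKernels] [(perpZ D).IsClosedUnderCokernels]
  [HasDerivedCategory.{w'} (perpZ D).FullSubcategory]

/-- The comparison functor from the bounded derived category of the perpendicular category of `D`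
to the Verdier quotient by `thick D`. -/
noncomputable abbrev perpToVerdierQuotient :
    Bounded (perpZ D).FullSubcategory ⥤ VerdierQuotient D :=
  mapBounded (perpZ D).ι ⋙ (thick D).trW.Q

variable {D}

lemma thickPerp_mapBounded
    (hP : IsHereditaryHeart (boundedStalkFunctor (perpZ D).FullSubcategory))
    (Y : Bounded (perpZ D).FullSubcategory) : thickPerp D ((mapBounded (perpZ D).ι).obj Y) := by
  have h : (thickPerp D).inverseImage (mapBounded (perpZ D).ι) = ⊤ := hP.eq_top fun M =>
    (thickPerp D).prop_of_iso ((boundedStalkFunctorCompMapBounded (perpZ D).ι).app M).symm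
      ((perpZ_iff D).1 M.property)
  exact h.ge Y trivial

lemma mapBijective_perpToVerdierQuotient
    (hP : IsHereditaryHeart (boundedStalkFunctor (perpZ D).FullSubcategory))
    {X Y : Bounded (perpZ D).FullSubcategory} (h : MapBijective (mapBounded (perpZ D).ι) X Y) :
    MapBijective (perpToVerdierQuotient D) X Y :=
  ((thickPerp_mapBounded hP Y).map_bijective_of_isTriangulated (thick D).trW.Q _).comp h

lemma essSurj_perpToVerdierQuotient {R : Type*} [Ring R] [Linear R H]
    (hs : IsHereditaryHeart (boundedStalkFunctor H)) (hD : IsPresilting D)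
    (hfin : ∀ (M : H) (n : ℤ), Module.Finite R (D ⟶ ((boundedStalkFunctor H).obj M)⟦n⟧))
    [(perpToVerdierQuotient D).Full] : (perpToVerdierQuotient D).EssSurj where
  mem_essImage Y := by
    let P := (perpToVerdierQuotient D).essImage
    have : P.IsTriangulated := inferInstanceAs (perpToVerdierQuotient D).essImage.IsTriangulated
    have htop : P.inverseImage (thick D).trW.Q = ⊤ :=
      hs.eq_top_of_isPresilting hD hfin _
        (fun X hX => P.prop_of_isZero (isZero_obj_of_isLocalization_trW (thick D) _ hX))
        fun M hM => ⟨(boundedStalkFunctor _).obj ⟨M, (perpZ_iff D).2 hM⟩,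
          ⟨(thick D).trW.Q.mapIso ((boundedStalkFunctorCompMapBounded (perpZ D).ι).app _)⟩⟩
    exact P.prop_of_iso ((thick D).trW.Q.objObjPreimageIso Y) (htop.ge _ trivial)

end VerdierQuotient

theorem proposition2p12_general (R : Type*) [Ring R] (H : Type u) [Category.{v} H] [Abelian H]
    [Linear R H] [HasExt.{t} H] (hH : ∀ X Y : H, Subsingleton (Abelian.Ext X Y 2))
    [HasDerivedCategory.{w} H] (D : DerivedCategory.Bounded H) (hD : IsPresilting D)
    (hfin : ∀ (M : H) (n : ℤ), Module.Finite R (D ⟶ (boundedStalk M)⟦n⟧)) :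
    ∃ (_ : (perpZ D).ContainsZero) (_ : (perpZ D).IsClosedUnderFiniteProducts)
      (_ : (perpZ D).IsClosedUnderKernels) (_ : (perpZ D).IsClosedUnderCokernels),
      (∀ [HasExt.{max u v} (perpZ D).FullSubcategory] (X Y : (perpZ D).FullSubcategory) (n : ℕ),
        Function.Bijective ((perpZ D).ι.mapExtAddHom X Y n)) ∧
      ∀ [HasDerivedCategory.{w'} (perpZ D).FullSubcategory],
        ∃ (F : DerivedCategory.Bounded (perpZ D).FullSubcategory ⥤ VerdierQuotient D)
          (_ : F.CommShift ℤ), F.IsTriangulated ∧ F.IsEquivalence ∧ F.Linear R := by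
  have hs : IsHereditaryHeart (boundedStalkFunctor H) := isHereditaryHeart_boundedStalkFunctor hH
  have := isClosedUnderKernels_perpZ D hs
  have := isClosedUnderCokernels_perpZ D hs
  have := isClosedUnderExtensions_perpZ D hs
  refine ⟨inferInstance, inferInstance, inferInstance, inferInstance,
    mapExtAddHom_bijective (perpZ D).ι hH, ?_⟩
  intro _
  have := HasExt.standard (perpZ D).FullSubcategory
  have hPext := subsingleton_ext_two (perpZ D).ι hH
  have hP := isHereditaryHeart_boundedStalkFunctor hPext
  have hbij X Y : MapBijective (perpToVerdierQuotient D) X Y :=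
    mapBijective_perpToVerdierQuotient hP (mapBijective_mapBounded (perpZ D).ι hPext
      (mapExtAddHom_bijective (perpZ D).ι hH) X Y)
  have : (perpToVerdierQuotient D).Full := ⟨fun {X Y} => (hbij X Y).2⟩
  have : (perpToVerdierQuotient D).Faithful := ⟨fun {X Y} => (hbij X Y).1⟩
  have := essSurj_perpToVerdierQuotient hs hD hfin
  exact ⟨perpToVerdierQuotient D, inferInstance, inferInstance, { }, inferInstance⟩

theorem proposition2p12 (k : Type t) [Field k] (H : Type u) [Category.{v} H] [Abelian H]
    [Linear k H] (hH : IsHereditaryAbelian k H) [HasDerivedCategory.{w} H]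
    (D : DerivedCategory.Bounded H) (hD : IsPresilting D) :
    ∃ (_ : (perpZ D).ContainsZero) (_ : (perpZ D).IsClosedUnderFiniteProducts)
      (_ : (perpZ D).IsClosedUnderKernels) (_ : (perpZ D).IsClosedUnderCokernels),
      IsHereditaryAbelian k (perpZ D).FullSubcategory ∧
      ∀ [HasDerivedCategory.{w'} (perpZ D).FullSubcategory],
        ∃ (F : DerivedCategory.Bounded (perpZ D).FullSubcategory ⥤ VerdierQuotient D)
          (_ : F.CommShift ℤ), F.IsTriangulated ∧ F.IsEquivalence ∧ F.Linear k := by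
  have := HasExt.standard H
  obtain ⟨_, _, _, _, hExt, hEquiv⟩ :=
    proposition2p12_general k H hH.ext_two D hD (hH.finite_hom D)
  exact ⟨inferInstance, inferInstance, inferInstance, inferInstance,
    hH.fullSubcategory (perpZ D) hExt, hEquiv⟩
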